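/- **Setting.** Let $n\ge 1$, $L,R>0$, and let $\log$ be the binary logarithm. Let $B=[-R,R]^n$. A point $x\in B$ is an $\varepsilon$-minimum of $f$ if $f(x)<\min_B f+\varepsilon$. *The family.* For an interval $I=[a,b]$ write $I(t)=a+(1+t)(b-a)/2$ and $I[t_1,t_2]=[I(t_1),I(t_2)]$. Put $b_0=1$ and $b_{k+1}=b_k-2\cdot 4^{-(k+1)}2^{-k}$. For the empty string let $I_\bot=[-1,1]$, $f_\bot(x)=|x|$. For a binary string $s$ of length $k$ let $I_{s0}=I_s[-\tfrac12,0]$, $I_{s1}=I_s[0,\tfrac12]$, and $$f_{s0}(x)=b_{k+1}-2^{-3(k+1)}+2^{-k-1}\,|x-I_s(-\tfrac14)|\ \text{ if } x\in I_s[-\tfrac12,1],\qquad f_{s0}(x)=f_s(x)\ \text{ otherwise},$$ $$f_{s1}(x)=b_{k+1}-2^{-3(k+1)}+2^{-k-1}\,|x-I_s(\tfrac14)|\ \text{ if } x\in I_s[-1,\tfrac12],\qquad f_{s1}(x)=f_s(x)\ \text{ otherwise}.$$ For $\varepsilon>0$ let $M=\lfloor\tfrac13\log\tfrac{LR}{\varepsilon}\rfloor$,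 and let $\mathcal F$ be the family of the functions $$f_{s_1,\dots,s_n}(x)=LR\,\max_{1\le i\le n} f_{s_i}(x_i/R),\qquad x\in B,\quad s_1,\dots,s_n\in\{0,1\}^M .$$ *Oracles.* A first-order oracle answers a query $x\in B$ on an instance $f$ by $f(x)$ and a subgradient of $f$ (as a function on $B$) at $x$. It is local if instances that agree on a neighbourhood of $x$ in $B$ receive the same answer at $x$. It is single-coordinate if the subgradient in the answer is always of the form $\lambda e_i$, where $i$ is the least coordinate such that some multiple of $e_i$ is a subgradient of $f$ at $x$. *Complexity.* The instance is uniformly random in $\mathcal F$. An algorithm adaptively queries the oracle, possibly using private randomness independent of the instance, and either stops and returns a point of $B$ or continues forever; $T$ is its number of queries. It has error at most $P_e$ if, with probability at least $1-P_e$ over the instance and its randomness, it stops and returns an $\varepsilon$-minimum of the instance. The distributional complexity with error $P_e$ is the infimum of $\mathbb E[T]$ over all algorithms with error at most $P_e$. For $\delta\in\mathbb R$, the high-probability complexity with error $P_e$ and slack $\delta$ is the infimum, over the same algorithms, of $\sup\{\tau\ge 0:\ \Pr[T\ge\tau]\ge 1-P_e-\delta\}$. **Theorem.** There are universal constants $c,K>0$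 and a function $\delta:\mathbb R\to\mathbb R$ with $\delta(X)\to0$ as $X\to\infty$ such that the following holds for all $n\ge1$, $L,R>0$ and $0<\varepsilon\le LR/8$. Write $X=n\log\frac{LR}{\varepsilon}$. The functions $f_{s_1,\dots,s_n}$ are pairwise distinct on $B$, convex on $B$, and Lipschitz continuous on $B$ with constant $L$ in the $L^\infty$ norm. There is a single-coordinate local first-order oracle for $\mathcal F$ for which: 1. the distributional complexity with error $0$ and the high-probability complexity with error $0$ and slack $\delta(X)$ of finding an $\varepsilon$-minimum are both at least $c\,n\log\frac{LR}{\varepsilon}$; 2. for every $0\le P_e<1$, the distributional complexity with error $P_e$ is at least $c\,(1-P_e)\,n\log\frac{LR}{\varepsilon}$ whenever $(1-P_e)\,n\log\frac{LR}{\varepsilon}\ge K$, and the high-probability complexity with error $P_e$ and slack $\delta(X)$ is at least $c\,n\log\frac{LR}{\varepsilon}$. -/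

import Mathlib

open Filter Topology
open scoped ENNReal

namespace BoxLowerBound

noncomputable section

/-! ### Convex minimisation on the box

Points are functions `Fin n → ℝ`, whose norm in Mathlib is the `L^∞` norm, so that the box
`[-R, R]^n` is a closed ball. -/

/-- The box `B_∞(0, R) = [-R, R]^n`. -/
abbrev box (n : ℕ) (R : ℝ) : Set (Fin n → ℝ) := Metric.closedBall 0 R

/-- `x` is an `ε`-minimum of `f` on `X`: a point of `X` with `f x < min_X f + ε`. -/
def IsEpsMin {E : Type*} (X : Set E) (f : E → ℝ) (ε : ℝ) (x : E) : Prop :=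
  x ∈ X ∧ f x < (⨅ y : X, f y) + ε

/-- `g` is a subgradient at `x` of the function `f` on `X`. -/
def IsSubgradient {n : ℕ} (X : Set (Fin n → ℝ)) (f : (Fin n → ℝ) → ℝ)
    (x g : Fin n → ℝ) : Prop :=
  ∀ y ∈ X, f x + g ⬝ᵥ (y - x) ≤ f y

/-! ### First-order oracles for an indexed family of functions on `X`

`O s x` is the answer (value, gradient part) to the query `x` for the instance `s`. -/

/-- The oracle answers with the value and a subgradient at the queried point. -/
def IsFirstOrder {n : ℕ} {ι : Type*} (X : Set (Fin n → ℝ)) (f : ι → (Fin n → ℝ) → ℝ)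
    (O : ι → X → ℝ × (Fin n → ℝ)) : Prop :=
  ∀ s (x : X), (O s x).1 = f s x ∧ IsSubgradient X (f s) x (O s x).2

/-- Two instances that agree on a neighbourhood (in `X`) of `x` get the same answer at `x`. -/
def IsLocal {n : ℕ} {ι : Type*} (X : Set (Fin n → ℝ)) (f : ι → (Fin n → ℝ) → ℝ)
    (O : ι → X → ℝ × (Fin n → ℝ)) : Prop :=
  ∀ s t (x : X), f s =ᶠ[𝓝[X] (x : Fin n → ℝ)] f t → O s x = O t x

/-- The subgradient in the answer is a multiple of a coordinate vector `e_i`, where `i` is the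
least coordinate for which some multiple of `e_i` is a subgradient. -/
def IsSingleCoordinate {n : ℕ} {ι : Type*} (X : Set (Fin n → ℝ)) (f : ι → (Fin n → ℝ) → ℝ)
    (O : ι → X → ℝ × (Fin n → ℝ)) : Prop :=
  ∀ s (x : X), ∃ (i : Fin n) (a : ℝ), (O s x).2 = Pi.single i a ∧
    ∀ j < i, ∀ b : ℝ, ¬ IsSubgradient X (f s) x (Pi.single j b)

/-! ### Algorithms querying an oracle

`Q` is the type of queries (and of returned solutions), `Y` the type of oracle answers. -/

/-- A deterministic algorithm: from the list of query-answer pairs so far it decides either to ask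
a further query (`Sum.inl`) or to stop and return a point (`Sum.inr`). -/
abbrev Algorithm (Q Y : Type*) : Type _ := List (Q × Y) → Q ⊕ Q

/-- The transcript of the run of `A` with the oracle `o` after `t` steps (a step after the
algorithm has stopped does nothing). -/
def transcript {Q Y : Type*} (A : Algorithm Q Y) (o : Q → Y) : ℕ → List (Q × Y)
  | 0 => []
  | t + 1 =>
    match A (transcript A o t) with
    | Sum.inl x => transcript A o t ++ [(x, o x)]
    | Sum.inr _ => transcript A o t

/-- The total number of queries asked in the run (`∞` if the algorithm never stops). -/
def queryCount {Q Y : Type*} (A : Algorithm Q Y) (o : Q → Y) : ℝ≥0∞ :=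
  ⨆ t : ℕ, ((transcript A o t).length : ℝ≥0∞)

/-- The run stops and returns a point of `G`. -/
def Succeeds {Q Y : Type*} (A : Algorithm Q Y) (o : Q → Y) (G : Set Q) : Prop :=
  ∃ t : ℕ, ∃ x ∈ G, A (transcript A o t) = Sum.inr x

/-- A possibly randomized algorithm for the oracle problem with oracles `O s` and solution
sets `G s`: a deterministic algorithm chosen by a private random seed, such that the number of
queries and the success event are measurable for every instance. Deterministic algorithms are the
case of a one-point seed space. -/
structure RandAlgorithm {ι Q Y : Type*} (O : ι → Q → Y) (G : ι → Set Q) where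
  Seed : Type
  [measurableSpace : MeasurableSpace Seed]
  law : MeasureTheory.Measure Seed
  [isProbabilityMeasure : MeasureTheory.IsProbabilityMeasure law]
  alg : Seed → Algorithm Q Y
  measurable_queryCount : ∀ s, Measurable fun ω => queryCount (alg ω) (O s)
  measurableSet_succeeds : ∀ s, MeasurableSet {ω | Succeeds (alg ω) (O s) (G s)}

attribute [instance] RandAlgorithm.measurableSpace RandAlgorithm.isProbabilityMeasure

section Complexity

variable {ι Q Y : Type*} [Fintype ι] {O : ι → Q → Y} {G : ι → Set Q}

/-- The expectation of the number `T` of queries, for a uniformly random instance independent of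
the seed. -/
def RandAlgorithm.expectedQueries (A : RandAlgorithm O G) : ℝ≥0∞ :=
  (∑ s, ∫⁻ ω, queryCount (A.alg ω) (O s) ∂A.law) / Fintype.card ι

/-- The probability of `T ≥ τ`, for a uniformly random instance independent of the seed. -/
def RandAlgorithm.probQueriesGE (A : RandAlgorithm O G) (τ : ℝ≥0∞) : ℝ≥0∞ :=
  (∑ s, A.law {ω | τ ≤ queryCount (A.alg ω) (O s)}) / Fintype.card ι

/-- The probability of returning a correct solution, for a uniformly random instance independent
of the seed. -/
def RandAlgorithm.successProb (A : RandAlgorithm O G) : ℝ≥0∞ :=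
  (∑ s, A.law {ω | Succeeds (A.alg ω) (O s) (G s)}) / Fintype.card ι

variable (O G)

/-- Distributional complexity for the uniform distribution on the instances: the infimum of the
expected number of queries over the algorithms whose error probability (across all instances) is
at most `Pe`. -/
def distComplexity (Pe : ℝ) : ℝ≥0∞ :=
  ⨅ (A : RandAlgorithm O G) (_ : ENNReal.ofReal (1 - Pe) ≤ A.successProb), A.expectedQueries

/-- High-probability complexity for the uniform distribution on the instances: the infimum, over
the algorithms whose error probability (across all instances) is at most `Pe`, of the supremum of
the `τ` such that at least `τ` queries are asked with probability at least `1 - Pe - δ`. -/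
def highProbComplexity (Pe δ : ℝ) : ℝ≥0∞ :=
  ⨅ (A : RandAlgorithm O G) (_ : ENNReal.ofReal (1 - Pe) ≤ A.successProb),
    sSup {τ : ℝ≥0∞ | ENNReal.ofReal (1 - Pe - δ) ≤ A.probQueriesGE τ}

end Complexity

/-! ### The recursive one-dimensional functions -/

/-- The levels `b_k`. -/
def breakpoint : ℕ → ℝ
  | 0 => 1
  | k + 1 => breakpoint k - 2 * (1 / 4) ^ (k + 1) * (1 / 2) ^ k

/-- The data attached to a string `s`: its length, the interval `I_s = [left, right]`, and the
function `f_s`. -/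
structure Stage where
  depth : ℕ
  left : ℝ
  right : ℝ
  fn : ℝ → ℝ

/-- The point `I(t) = a + (1 + t) (b - a) / 2` of the interval `I = [a, b]`. -/
def Stage.pt (σ : Stage) (t : ℝ) : ℝ := σ.left + (1 + t) * (σ.right - σ.left) / 2

/-- The data of the empty string. -/
def Stage.root : Stage := ⟨0, -1, 1, fun x => |x|⟩

open Classical in
/-- Appending a bit to the string: `false` (bit 0) is the right modification, `true` (bit 1) is the
left modification, its mirror image with respect to the midpoint of the interval. -/
def Stage.extend (σ : Stage) : Bool → Stage
  | false =>
    { depth := σ.depth + 1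
      left := σ.pt (-1 / 2)
      right := σ.pt 0
      fn := fun x =>
        if x ∈ Set.Icc (σ.pt (-1 / 2)) (σ.pt 1) then
          breakpoint (σ.depth + 1) - (1 / 2) ^ (3 * (σ.depth + 1))
            + (1 / 2) ^ (σ.depth + 1) * |x - σ.pt (-1 / 4)|
        else σ.fn x }
  | true =>
    { depth := σ.depth + 1
      left := σ.pt 0
      right := σ.pt (1 / 2)
      fn := fun x =>
        if x ∈ Set.Icc (σ.pt (-1)) (σ.pt (1 / 2)) then
          breakpoint (σ.depth + 1) - (1 / 2) ^ (3 * (σ.depth + 1))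
            + (1 / 2) ^ (σ.depth + 1) * |x - σ.pt (1 / 4)|
        else σ.fn x }

/-- The data of the binary string `s`, read from its first bit to its last. -/
def stage (s : List Bool) : Stage := s.foldl Stage.extend Stage.root

/-- The one-dimensional function `f_s`. -/
def nestedFn (s : List Bool) : ℝ → ℝ := (stage s).fn

/-! ### The family on the box -/

/-- The length `M = ⌊(1/3) log₂ (LR/ε)⌋` of the strings. -/
def stringLength (L R ε : ℝ) : ℕ := ⌊Real.logb 2 (L * R / ε) / 3⌋₊

/-- The member `x ↦ L R max_i f_{s_i}(x_i / R)` of the family, for `n` strings of length `M`. -/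
def boxFn (n M : ℕ) (L R : ℝ) (s : Fin n → Fin M → Bool) (x : Fin n → ℝ) : ℝ :=
  L * R * ⨆ i, nestedFn (List.ofFn (s i)) (x i / R)

/-- The `ε`-minima of a function on the box, as a set of points of the box. -/
def epsMinima (n : ℕ) (R ε : ℝ) (f : (Fin n → ℝ) → ℝ) : Set (box n R) :=
  {x | IsEpsMin (box n R) f ε x}

end

end BoxLowerBound

open BoxLowerBound

/-! The function f_s is the maximum of vees, one on each of the nested intervals I_u for the
prefixes u of s (`nestedFn_concat`); this gives convexity and the Lipschitz bound. Outside the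
interior of I_u the bits after u change nothing (`nestedFn_append_eq`). Inside it, one value of the
next bit throws the point out of the next interval, and this exit bit yields the largest value that
the function can still have there (`exists_exit_bit`).

Hence an answer about the maximum over the coordinates is found by always looking at the least
coordinate with the largest possible value. If its next bit is the exit bit, the bound is attained
and the answer is settled; otherwise one more bit is known and the game goes on
(`guessChain_of_max`). A query therefore reveals bits only up to the first wrong guess, about two on
average.

This is made exact by giving a cube of dimension d of instances the weight (3/2)^d. A query cuts it
into subcubes of dimensions d-1, d-2, ..., whose total weight is at most twice that of the cube
(`GuessChain.ncard_inter_le`). Distinct instances have no common ε-minimum, so a returned point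
solves at most one. With m = nM bits, t queries thus solve at most 2^t (3/2)^m of the 2^m instances
(`ncard_cube_inter_le`), a fraction of at most (9/10)^m for t ≤ m/4. Averaging over the seed gives
the high-probability bound, and Markov's inequality the bound in expectation.

The oracle has to be local, and at an endpoint of I_u it must not leak later bits. `steepSlope`
picks the one-sided derivative that looks away from the minimum point. -/

namespace BoxLowerBound

open Set

/-! ### The one-dimensional functions as maxima of vees -/

/-- The sign of a bit: `-1` for the right modification, `1` for the left one. -/
def bitSign (b : Bool) : ℝ := if b then 1 else -1

lemma abs_bitSign (b : Bool) : |bitSign b| = 1 := by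
  cases b <;> simp [bitSign]

/-- The affine coordinate on the line that maps the interval `I_u` onto `[-1, 1]`. -/
noncomputable def coord (u : List Bool) (x : ℝ) : ℝ := u.foldl (fun τ b => 4 * τ - bitSign b) x

/-- The vee that the last modification of the string `u` installs on `I_u`. -/
noncomputable def vee (u : List Bool) (x : ℝ) : ℝ :=
  breakpoint u.length + (1 / 8) ^ u.length * (|coord u x| - 1)

/-- The midpoint of `I_u`. -/
noncomputable def center (u : List Bool) : ℝ := (stage u).pt 0

lemma coord_concat (u : List Bool) (b : Bool) (x : ℝ) :
    coord (u ++ [b]) x = 4 * coord u x - bitSign b := by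
  simp [coord, List.foldl_append]

lemma stage_concat (u : List Bool) (b : Bool) : stage (u ++ [b]) = (stage u).extend b := by
  simp [stage, List.foldl_append]

lemma stage_depth (u : List Bool) : (stage u).depth = u.length := by
  induction u using List.reverseRecOn with
  | nil => rfl
  | append_singleton u b ih => rw [stage_concat]; cases b <;> simp [Stage.extend, ih]

/-- The natural scale at depth k is 8^(-k): half-width 4^(-k) of the interval times slope 2^(-k) of
the vee. -/
lemma breakpoint_succ (k : ℕ) : breakpoint (k + 1) = breakpoint k - (1 / 8) ^ k / 2 := by
  rw [breakpoint, pow_succ, show (1 / 8 : ℝ) = 1 / 4 * (1 / 2) by norm_num, mul_pow]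
  ring

lemma breakpoint_antitone : Antitone breakpoint :=
  antitone_nat_of_succ_le fun k => by
    rw [breakpoint_succ]
    have : (0 : ℝ) < (1 / 8) ^ k := by positivity
    linarith

lemma stage_width (u : List Bool) :
    (stage u).right - (stage u).left = 2 * (1 / 4) ^ u.length := by
  induction u using List.reverseRecOn with
  | nil => simp [stage, Stage.root]; norm_num
  | append_singleton u b ih =>
    have h : (stage u).right = (stage u).left + 2 * (1 / 4) ^ u.length := by linarith
    rw [stage_concat, List.length_append, List.length_singleton, pow_succ]
    cases b <;> simp only [Stage.extend, Stage.pt, h] <;> ring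

lemma stage_pt (u : List Bool) (t : ℝ) : (stage u).pt t = center u + t * (1 / 4) ^ u.length := by
  have h : (stage u).right = (stage u).left + 2 * (1 / 4) ^ u.length := by
    linarith [stage_width u]
  simp only [center, Stage.pt, h]; ring

lemma center_concat (u : List Bool) (b : Bool) :
    center (u ++ [b]) = center u + bitSign b / 4 * (1 / 4) ^ u.length := by
  have h : (stage u).right = (stage u).left + 2 * (1 / 4) ^ u.length := by
    linarith [stage_width u]
  rw [center, stage_concat]
  cases b <;> simp [Stage.extend, center, Stage.pt, h, bitSign] <;> ring

lemma eq_center_add (u : List Bool) (x : ℝ) :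
    x = center u + coord u x * (1 / 4) ^ u.length := by
  induction u using List.reverseRecOn with
  | nil => simp [center, stage, Stage.root, Stage.pt, coord]
  | append_singleton u b ih =>
    rw [coord_concat, center_concat, List.length_append, List.length_singleton, pow_succ]
    linear_combination ih

lemma coord_le_coord_iff (u : List Bool) (x y : ℝ) : coord u x ≤ coord u y ↔ x ≤ y := by
  have hp : (0 : ℝ) < (1 / 4) ^ u.length := by positivity
  conv_rhs => rw [eq_center_add u x, eq_center_add u y]
  rw [add_le_add_iff_left, mul_le_mul_iff_left₀ hp]

lemma coord_lt_coord_iff (u : List Bool) (x y : ℝ) : coord u x < coord u y ↔ x < y := by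
  simpa using (coord_le_coord_iff u y x).not

lemma coord_center (u : List Bool) : coord u (center u) = 0 := by
  have hp : (0 : ℝ) < (1 / 4) ^ u.length := by positivity
  have := eq_center_add u (center u)
  have h : coord u (center u) * (1 / 4) ^ u.length = 0 := by linarith
  exact (mul_eq_zero.1 h).resolve_right hp.ne'

lemma coord_pt (u : List Bool) (t : ℝ) : coord u ((stage u).pt t) = t := by
  have hp : (0 : ℝ) < (1 / 4) ^ u.length := by positivity
  have h1 := eq_center_add u ((stage u).pt t)
  rw [stage_pt] at h1
  have h2 : coord u (center u + t * (1 / 4) ^ u.length) = t :=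
    mul_right_cancel₀ hp.ne' (by linarith)
  rw [stage_pt, h2]

lemma vee_concat (u : List Bool) (b : Bool) (x : ℝ) :
    vee (u ++ [b]) x =
      breakpoint u.length + (1 / 8) ^ u.length * (|coord u x - bitSign b / 4| / 2 - 5 / 8) := by
  rw [vee, coord_concat, List.length_append, List.length_singleton, breakpoint_succ, pow_succ,
    show 4 * coord u x - bitSign b = 4 * (coord u x - bitSign b / 4) by ring, abs_mul,
    abs_of_pos (four_pos : (0 : ℝ) < 4)]
  ring

lemma vee_concat_le_vee (u : List Bool) (b : Bool) {x : ℝ} (h : 1 ≤ |coord u x|) :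
    vee (u ++ [b]) x ≤ vee u x := by
  rw [vee_concat, vee]
  gcongr _ + _ * ?_
  have := abs_sub (coord u x) (bitSign b / 4)
  rw [abs_div, abs_bitSign, abs_of_pos (four_pos : (0 : ℝ) < 4)] at this
  linarith

/-- The recursion for the functions, with the domain of the last modification in terms of the
coordinate on the previous interval. -/
lemma nestedFn_concat_eq_ite (u : List Bool) (b : Bool) (x : ℝ)
    [Decidable (|bitSign b * coord u x + 1 / 4| ≤ 3 / 4)] :
    nestedFn (u ++ [b]) x =
      if |bitSign b * coord u x + 1 / 4| ≤ 3 / 4 then vee (u ++ [b]) x else nestedFn u x := by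
  have key : ∀ v : ℝ, breakpoint ((stage u).depth + 1) - (1 / 2) ^ (3 * ((stage u).depth + 1)) +
      (1 / 2) ^ ((stage u).depth + 1) * |x - (stage u).pt v| =
      breakpoint u.length + (1 / 8) ^ u.length * (|coord u x - v| / 2 - 5 / 8) := by
    intro v
    have e : x - (stage u).pt v = (coord u x - v) * (1 / 4) ^ u.length := by
      rw [stage_pt]; linear_combination eq_center_add u x
    have hp : (0 : ℝ) < (1 / 4) ^ u.length := by positivity
    rw [e, abs_mul, abs_of_pos hp, stage_depth, breakpoint_succ, pow_mul,
      show ((1 / 2 : ℝ) ^ 3) = 1 / 2 * (1 / 4) by norm_num, pow_succ, pow_succ,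
      show (1 / 8 : ℝ) = 1 / 2 * (1 / 4) by norm_num, mul_pow]
    ring
  have mem : ∀ s t : ℝ, x ∈ Icc ((stage u).pt s) ((stage u).pt t) ↔
      s ≤ coord u x ∧ coord u x ≤ t := by
    intro s t
    rw [mem_Icc, ← coord_le_coord_iff u _ x, ← coord_le_coord_iff u x, coord_pt, coord_pt]
  rw [nestedFn, stage_concat]
  cases b
  · simp only [Stage.extend, mem, key]
    rw [vee_concat]
    have : (-1 / 2 ≤ coord u x ∧ coord u x ≤ 1) ↔
        |bitSign false * coord u x + 1 / 4| ≤ 3 / 4 := by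
      rw [abs_le]; simp only [bitSign]
      constructor <;> rintro ⟨h1, h2⟩ <;> constructor <;> norm_num at * <;> linarith
    simp only [this]
    split_ifs
    · simp only [bitSign]; norm_num
    · rfl
  · simp only [Stage.extend, mem, key]
    rw [vee_concat]
    have : (-1 ≤ coord u x ∧ coord u x ≤ 1 / 2) ↔
        |bitSign true * coord u x + 1 / 4| ≤ 3 / 4 := by
      rw [abs_le]; simp only [bitSign]
      constructor <;> rintro ⟨h1, h2⟩ <;> constructor <;> norm_num at * <;> linarith
    simp only [this]
    split_ifs
    · simp only [bitSign]; norm_num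
    · rfl

/-- With σ the sign of b, the old and the new vee cross exactly at the coordinates -σ and σ/2, the
ends of the domain of the modification. The new vee is half as steep, so it lies above the old one
between them and below it elsewhere. -/
lemma vee_concat_le_vee_of_not (u : List Bool) (b : Bool) {x : ℝ}
    (h : ¬ |bitSign b * coord u x + 1 / 4| ≤ 3 / 4) : vee (u ++ [b]) x ≤ vee u x := by
  rw [vee_concat, vee]
  gcongr _ + _ * ?_
  rw [abs_le] at h
  cases b <;> simp only [bitSign] at h ⊢ <;> norm_num at h ⊢ <;>
    cases abs_cases (coord u x) <;> first
    | (cases abs_cases (coord u x + 1 / 4) <;> by_contra <;> have := h (by linarith) <;> linarith)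
    | (cases abs_cases (coord u x - 1 / 4) <;> by_contra <;> have := h (by linarith) <;> linarith)

lemma vee_le_vee_concat (u : List Bool) (b : Bool) {x : ℝ}
    (h : |bitSign b * coord u x + 1 / 4| ≤ 3 / 4) : vee u x ≤ vee (u ++ [b]) x := by
  rw [vee_concat, vee]
  gcongr _ + _ * ?_
  rw [abs_le] at h
  cases b <;> simp only [bitSign] at h ⊢ <;> norm_num at h ⊢ <;>
    cases abs_cases (coord u x) <;> first
    | (cases abs_cases (coord u x + 1 / 4) <;> linarith)
    | (cases abs_cases (coord u x - 1 / 4) <;> linarith)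

/-- Off the domain of the last modification the new vee is below the previous one, and induction
applies. The new interval lies inside this domain, where the function is the vee by definition. -/
lemma vee_le_nestedFn_and (u : List Bool) (x : ℝ) :
    vee u x ≤ nestedFn u x ∧ (|coord u x| ≤ 1 → nestedFn u x = vee u x) := by
  classical
  induction u using List.reverseRecOn with
  | nil => simp [vee, nestedFn, stage, Stage.root, breakpoint, coord]
  | append_singleton u b ih =>
    rw [nestedFn_concat_eq_ite]
    split_ifs with h
    · simp
    · refine ⟨(vee_concat_le_vee_of_not u b h).trans ih.1, fun h' => absurd ?_ h⟩
      rw [coord_concat, abs_le] at h'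
      rw [abs_le]
      cases b <;> simp only [bitSign] at h' ⊢ <;> norm_num at h' ⊢ <;>
        constructor <;> linarith

lemma vee_le_nestedFn (u : List Bool) (x : ℝ) : vee u x ≤ nestedFn u x :=
  (vee_le_nestedFn_and u x).1

lemma nestedFn_eq_vee {u : List Bool} {x : ℝ} (h : |coord u x| ≤ 1) : nestedFn u x = vee u x :=
  (vee_le_nestedFn_and u x).2 h

/-- The domain of the modification is contained in I_u, where the old function is just its last vee;
so the case distinction of the definition compares two vees. -/
lemma nestedFn_concat (u : List Bool) (b : Bool) (x : ℝ) :
    nestedFn (u ++ [b]) x = max (nestedFn u x) (vee (u ++ [b]) x) := by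
  classical
  rw [nestedFn_concat_eq_ite]
  split_ifs with h
  · have hx : |coord u x| ≤ 1 := by
      rw [abs_le] at h ⊢
      cases b <;> simp only [bitSign] at h <;> norm_num at h <;> constructor <;> linarith
    rw [nestedFn_eq_vee hx, max_eq_right (vee_le_vee_concat u b h)]
  · exact (max_eq_left ((vee_concat_le_vee_of_not u b h).trans (vee_le_nestedFn u x))).symm

lemma vee_eq (u : List Bool) (x : ℝ) :
    vee u x = breakpoint u.length - (1 / 8) ^ u.length + (1 / 2) ^ u.length * |x - center u| := by
  have hp : (0 : ℝ) < (1 / 4) ^ u.length := by positivity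
  have e : x - center u = coord u x * (1 / 4) ^ u.length := by
    linear_combination eq_center_add u x
  rw [e, vee, abs_mul, abs_of_pos hp, show (1 / 8 : ℝ) = 1 / 2 * (1 / 4) by norm_num, mul_pow]
  ring

lemma convexOn_vee (u : List Bool) : ConvexOn ℝ univ (vee u) := by
  have h1 : ConvexOn ℝ univ fun x : ℝ => |x - center u| := by
    simpa [Function.comp_def, sub_eq_add_neg, Real.norm_eq_abs] using
      (convexOn_univ_norm (E := ℝ)).translate_left (-center u)
  have h2 := (h1.smul (c := (1 / 2 : ℝ) ^ u.length) (by positivity)).add_const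
    (breakpoint u.length - (1 / 8) ^ u.length)
  refine h2.congr fun x _ => ?_
  simp only [vee_eq, Pi.add_apply, smul_eq_mul]
  ring

lemma convexOn_nestedFn (u : List Bool) : ConvexOn ℝ univ (nestedFn u) := by
  induction u using List.reverseRecOn with
  | nil => exact convexOn_univ_norm (E := ℝ)
  | append_singleton u b ih =>
    exact (ih.sup (convexOn_vee (u ++ [b]))).congr fun x _ => (nestedFn_concat u b x).symm

lemma abs_vee_sub_le (u : List Bool) (x y : ℝ) : |vee u x - vee u y| ≤ |x - y| := by
  have h : vee u x - vee u y = (1 / 2) ^ u.length * (|x - center u| - |y - center u|) := by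
    rw [vee_eq, vee_eq]; ring
  have hp : (0 : ℝ) < (1 / 2) ^ u.length := by positivity
  have h1 : (1 / 2 : ℝ) ^ u.length ≤ 1 := pow_le_one₀ (by norm_num) (by norm_num)
  rw [h, abs_mul, abs_of_pos hp]
  refine (mul_le_of_le_one_left (abs_nonneg _) h1).trans ((abs_abs_sub_abs_le _ _).trans_eq ?_)
  ring_nf

lemma abs_nestedFn_sub_le (u : List Bool) (x y : ℝ) :
    |nestedFn u x - nestedFn u y| ≤ |x - y| := by
  induction u using List.reverseRecOn with
  | nil => exact abs_abs_sub_abs_le x y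
  | append_singleton u b ih =>
    rw [nestedFn_concat, nestedFn_concat]
    exact (abs_max_sub_max_le_max _ _ _ _).trans (max_le ih (abs_vee_sub_le _ x y))

/-! ### Nested intervals -/

lemma abs_coord_le_half {u : List Bool} {b : Bool} {x : ℝ} (h : |coord (u ++ [b]) x| ≤ 1) :
    |coord u x| ≤ 1 / 2 := by
  rw [coord_concat, abs_le] at h
  rw [abs_le]
  cases b <;> simp only [bitSign] at h <;> norm_num at h <;> constructor <;> linarith

lemma abs_coord_lt_one_of_append {u : List Bool} (w : List Bool) {x : ℝ}
    (h : |coord (u ++ w) x| < 1) : |coord u x| < 1 := by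
  induction w using List.reverseRecOn with
  | nil => simpa using h
  | append_singleton w b ih =>
    rw [← List.append_assoc] at h
    exact ih ((abs_coord_le_half h.le).trans_lt (by norm_num))

/-- The two children of an interval share only its midpoint, so equally deep intervals have disjoint
interiors. -/
lemma eq_of_abs_coord_lt_one {u v : List Bool} (hl : u.length = v.length) {x : ℝ}
    (hu : |coord u x| < 1) (hv : |coord v x| < 1) : u = v := by
  induction u using List.reverseRecOn generalizing v with
  | nil => exact (List.length_eq_zero_iff.1 hl.symm).symm
  | append_singleton u b ih =>
    obtain rfl | ⟨v, c, rfl⟩ := v.eq_nil_or_concat'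
    · simp at hl
    · have huv : u = v := ih (by simpa using hl) ((abs_coord_le_half hu.le).trans_lt (by norm_num))
        ((abs_coord_le_half hv.le).trans_lt (by norm_num))
      subst huv
      rw [coord_concat, abs_lt] at hu hv
      have : b = c := by
        cases b <;> cases c <;> simp only [bitSign] at hu hv <;> norm_num at hu hv ⊢ <;> linarith
      rw [this]

lemma abs_center_le_one (u : List Bool) : |center u| ≤ 1 := by
  have := abs_coord_lt_one_of_append (u := []) u (x := center u) (by simp [coord_center])
  exact this.le

/-- The minimum of the function of a string of length `k`. -/
noncomputable def minValue (k : ℕ) : ℝ := breakpoint k - (1 / 8) ^ k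

lemma minValue_le_nestedFn (u : List Bool) (x : ℝ) : minValue u.length ≤ nestedFn u x := by
  refine le_trans ?_ (vee_le_nestedFn u x)
  have : (0 : ℝ) < (1 / 8) ^ u.length := by positivity
  rw [minValue, vee]
  nlinarith [abs_nonneg (coord u x), mul_nonneg this.le (abs_nonneg (coord u x))]

lemma nestedFn_center (u : List Bool) : nestedFn u (center u) = minValue u.length := by
  rw [nestedFn_eq_vee (by simp [coord_center]), vee, coord_center, minValue]
  simp; ring

/-- The level b_k is a certificate: the vee of u is at least b_k off the interior of I_u. -/
lemma abs_coord_lt_one_of_lt {u : List Bool} {x : ℝ} (h : nestedFn u x < breakpoint u.length) :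
    |coord u x| < 1 := by
  by_contra! h'
  have := (vee_le_nestedFn u x).trans_lt h
  rw [vee] at this
  have hp : (0 : ℝ) < (1 / 8) ^ u.length := by positivity
  nlinarith [mul_nonneg hp.le (sub_nonneg.2 h')]

lemma breakpoint_le_nestedFn {u : List Bool} {x : ℝ} (h : 1 ≤ |coord u x|) :
    breakpoint u.length ≤ nestedFn u x := by
  by_contra! h'
  exact (abs_coord_lt_one_of_lt h').not_ge h

lemma nestedFn_append_eq {u : List Bool} (w : List Bool) {x : ℝ} (h : 1 ≤ |coord u x|) :
    nestedFn (u ++ w) x = nestedFn u x := by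
  induction w using List.reverseRecOn with
  | nil => simp
  | append_singleton w b ih =>
    have h' : 1 ≤ |coord (u ++ w) x| := by
      by_contra! h'
      exact (abs_coord_lt_one_of_append w h').not_ge h
    rw [← List.append_assoc, nestedFn_concat, max_eq_left, ih]
    exact (vee_concat_le_vee _ b h').trans (vee_le_nestedFn _ x)

/-- A later vee is dominated by an earlier one outside its parent interval, and inside the parent it
does not exceed the parent's level, which is at most that of u. -/
lemma nestedFn_append_le (u w : List Bool) (x : ℝ) :
    nestedFn (u ++ w) x ≤ max (breakpoint u.length) (nestedFn u x) := by
  induction w using List.reverseRecOn with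
  | nil => simp
  | append_singleton w b ih =>
    rw [← List.append_assoc, nestedFn_concat]
    refine max_le ih ?_
    rcases le_or_gt 1 |coord (u ++ w) x| with h | h
    · exact ((vee_concat_le_vee _ b h).trans (vee_le_nestedFn _ x)).trans ih
    · refine le_trans ?_ (le_max_left _ _)
      refine le_trans ?_ (breakpoint_antitone (show u.length ≤ (u ++ w).length by simp))
      rw [vee_concat]
      have h2 := abs_sub (coord (u ++ w) x) (bitSign b / 4)
      rw [abs_div, abs_bitSign, abs_of_pos (four_pos : (0 : ℝ) < 4)] at h2
      have hp : (0 : ℝ) < (1 / 8) ^ (u ++ w).length := by positivity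
      nlinarith

/-- Inside `I_u` one of the two bits leaves the point outside the next interval, and then gives the
largest value that the function may have at this point. -/
lemma exists_exit_bit {u : List Bool} {x : ℝ} (h : |coord u x| < 1) :
    ∃ b : Bool, 1 ≤ |coord (u ++ [b]) x| ∧
      ∀ w, nestedFn (u ++ w) x ≤ nestedFn (u ++ [b]) x := by
  -- The exit bit selects the child on the other side of the midpoint from x; at the midpoint either
  -- bit does.
  obtain ⟨b, hb⟩ : ∃ b : Bool, bitSign b * coord u x ≤ 0 := by
    rcases le_total 0 (coord u x) with h0 | h0
    · exact ⟨false, by simp [bitSign, h0]⟩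
    · exact ⟨true, by simp [bitSign, h0]⟩
  have hs : bitSign b = 1 ∨ bitSign b = -1 := by cases b <;> simp [bitSign]
  rw [abs_lt] at h
  have hexit : 1 ≤ |coord (u ++ [b]) x| := by
    rw [coord_concat, le_abs]
    rcases hs with hs | hs <;> rw [hs] at hb ⊢
    · right; linarith
    · left; linarith
  -- The child on the far side has its centre farther from x, hence the larger vee.
  have hother : vee (u ++ [!b]) x ≤ vee (u ++ [b]) x := by
    rw [vee_concat, vee_concat]
    gcongr _ + _ * (?_ / 2 - _)
    rcases b with _ | _ <;> simp only [bitSign] at hb ⊢ <;> norm_num at hb ⊢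
    · cases abs_cases (coord u x - 1 / 4) <;> cases abs_cases (coord u x + 1 / 4) <;> linarith
    · cases abs_cases (coord u x - 1 / 4) <;> cases abs_cases (coord u x + 1 / 4) <;> linarith
  refine ⟨b, hexit, fun w => ?_⟩
  rcases w with _ | ⟨c, w⟩
  · rw [List.append_nil, nestedFn_concat]; exact le_max_left _ _
  rw [show u ++ c :: w = (u ++ [c]) ++ w by simp]
  -- After any next bit c, the later bits lift the value at most to the level of the next depth,
  -- which the exit bit already reaches.
  refine (nestedFn_append_le _ _ _).trans (max_le ?_ ?_)
  · rw [show (u ++ [c]).length = (u ++ [b]).length by simp]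
    exact breakpoint_le_nestedFn hexit
  · rw [nestedFn_concat, nestedFn_concat]
    refine max_le_max le_rfl ?_
    rcases eq_or_ne c b with rfl | hc
    · exact le_rfl
    · rwa [show c = !b by cases c <;> cases b <;> simp_all]

/-! ### Answers that are found by guessing bits until the first wrong guess -/

section GuessChain

variable {I P Y Q : Type*} (bit : I → P → Bool)

/-- On the instances of `S` the answer `a` is determined by a sequence of guesses of bits that ends
with the first wrong guess. -/
inductive GuessChain (a : I → Y) : Set I → Prop
  | const {S : Set I} (h : ∀ s ∈ S, ∀ t ∈ S, a s = a t) : GuessChain a S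
  | guess {S : Set I} (p : P) (b : Bool)
      (wrong : ∀ s ∈ S, ∀ t ∈ S, bit s p ≠ b → bit t p ≠ b → a s = a t)
      (right : GuessChain a {s ∈ S | bit s p = b}) : GuessChain a S

variable {bit}

lemma GuessChain.mono {a : I → Y} {S S' : Set I} (h : GuessChain bit a S) (hS : S' ⊆ S) :
    GuessChain bit a S' := by
  induction h generalizing S' with
  | const h => exact .const fun s hs t ht => h s (hS hs) t (hS ht)
  | guess p b wrong _ ih =>
    exact .guess p b (fun s hs t ht => wrong s (hS hs) t (hS ht))
      (ih fun s hs => ⟨hS hs.1, hs.2⟩)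

variable (bit) in
/-- The instances whose bits at the positions of `F` are those of `r`. -/
def cube (F : Finset P) (r : P → Bool) : Set I := {s | ∀ p ∈ F, bit s p = r p}

variable [Fintype P] [DecidableEq P] [Finite I]

/-- If every subcube with a constant answer contains few elements of `E`, measured by the weight
`(3 / 2) ^ dim`, so does the cube, with twice the constant. -/
lemma GuessChain.ncard_inter_le {a : I → Y} {S E : Set I} (h : GuessChain bit a S) {κ : ℝ}
    (hκ : 0 ≤ κ) {F : Finset P} {r : P → Bool} (hS : cube bit F r ⊆ S)
    (hE : ∀ F' r', cube bit F' r' ⊆ cube bit F r →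
      (∀ s ∈ cube bit F' r', ∀ t ∈ cube bit F' r', a s = a t) →
      ((cube bit F' r' ∩ E).ncard : ℝ) ≤ κ * (3 / 2) ^ (F'ᶜ).card) :
    ((cube bit F r ∩ E).ncard : ℝ) ≤ 2 * κ * (3 / 2) ^ (Fᶜ).card := by
  have hle : κ * (3 / 2) ^ (Fᶜ).card ≤ 2 * κ * (3 / 2) ^ (Fᶜ).card := by
    have : 0 ≤ κ * (3 / 2) ^ (Fᶜ).card := by positivity
    linarith
  induction h generalizing F r with
  | const h => exact (hE F r subset_rfl fun s hs t ht => h s (hS hs) t (hS ht)).trans hle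
  | guess p b wrong _ ih =>
    -- If the guessed bit is fixed on the cube, the guess either costs nothing or is wrong
    -- throughout, so that the answer is constant.
    by_cases hp : p ∈ F
    · by_cases hb : r p = b
      · exact ih (fun s hs => ⟨hS hs, (hs p hp).trans hb⟩) hE hle
      · refine (hE F r subset_rfl fun s hs t ht => wrong s (hS hs) t (hS ht) ?_ ?_).trans hle
        · rwa [hs p hp]
        · rwa [ht p hp]
    · have hsub : ∀ c, cube bit (insert p F) (Function.update r p c) =
          {s ∈ cube bit F r | bit s p = c} := by
        intro c
        ext s
        simp only [cube, Finset.forall_mem_insert, Function.update_self, mem_ofPred_eq]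
        rw [and_comm]
        refine and_congr_left fun _ => forall₂_congr fun q hq => ?_
        rw [Function.update_of_ne (ne_of_mem_of_not_mem hq hp)]
      have hsub' : ∀ c, cube bit (insert p F) (Function.update r p c) ⊆ cube bit F r := fun c => by
        rw [hsub]; exact sep_subset _ _
      have hcard : (Fᶜ).card = ((insert p F)ᶜ).card + 1 := by
        rw [Finset.card_compl, Finset.card_compl, Finset.card_insert_of_notMem hp]
        have : F.card < Fintype.card P := Finset.card_lt_univ_of_notMem hp
        omega
      have hκ' : 0 ≤ κ * (3 / 2) ^ ((insert p F)ᶜ).card := by positivity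
      have h1 : ((cube bit (insert p F) (Function.update r p b) ∩ E).ncard : ℝ) ≤
          2 * κ * (3 / 2) ^ ((insert p F)ᶜ).card := by
        refine ih ?_ (fun F' r' h => hE F' r' (h.trans (hsub' b))) (by linarith)
        rw [hsub]
        exact fun s hs => ⟨hS hs.1, hs.2⟩
      have h2 : ((cube bit (insert p F) (Function.update r p !b) ∩ E).ncard : ℝ) ≤
          κ * (3 / 2) ^ ((insert p F)ᶜ).card := by
        refine hE _ _ (hsub' _) ?_
        rw [hsub]
        refine fun s hs t ht => wrong s (hS hs.1) t (hS ht.1) ?_ ?_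
        · rw [hs.2]; simp
        · rw [ht.2]; simp
      have hunion : cube bit F r ∩ E ⊆ (cube bit (insert p F) (Function.update r p b) ∩ E) ∪
          (cube bit (insert p F) (Function.update r p !b) ∩ E) := by
        rintro s ⟨hs, hsE⟩
        rw [hsub, hsub]
        by_cases hb : bit s p = b
        · exact Or.inl ⟨⟨hs, hb⟩, hsE⟩
        · exact Or.inr ⟨⟨hs, by simpa [← Bool.not_eq] using hb⟩, hsE⟩
      have h3 : ((cube bit F r ∩ E).ncard : ℝ) ≤
          (cube bit (insert p F) (Function.update r p b) ∩ E).ncard +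
          (cube bit (insert p F) (Function.update r p !b) ∩ E).ncard := by
        exact_mod_cast (ncard_le_ncard hunion (toFinite _)).trans (ncard_union_le _ _)
      -- The right half contributes 2κ and the wrong half κ, each times (3/2)^(d-1), and 3κ
      -- (3/2)^(d-1) = 2κ (3/2)^d. This balance is why the base is 3/2.
      rw [hcard, pow_succ]
      linarith

/-! ### Few instances are solved with few queries -/

omit [Fintype P] [DecidableEq P] [Finite I] in
lemma transcript_eq_of_stopped {A : Algorithm Q Y} {o : Q → Y} {j k : ℕ} (hjk : j ≤ k) {x : Q}
    (h : A (transcript A o j) = Sum.inr x) : transcript A o k = transcript A o j := by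
  induction k, hjk using Nat.le_induction with
  | base => rfl
  | succ k _ ih => rw [transcript, ih, h]

/-- Induction on the remaining queries t: each query cuts the cube into subcubes on which the
transcript is again common, at the price of a factor 2. -/
lemma ncard_cube_inter_le {O : I → Q → Y} {G : I → Set Q}
    (hO : ∀ x, GuessChain bit (fun s => O s x) univ)
    (hG : ∀ s t x, x ∈ G s → x ∈ G t → s = t) (A : Algorithm Q Y) (t j : ℕ) (h : List (Q × Y))
    (F : Finset P) (r : P → Bool) (hh : ∀ s ∈ cube bit F r, transcript A (O s) j = h) :
    ((cube bit F r ∩ {s | ∃ k ≤ j + t, ∃ x ∈ G s, A (transcript A (O s) k) = Sum.inr x}).ncard : ℝ)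
      ≤ 2 ^ t * (3 / 2) ^ (Fᶜ).card := by
  induction t using Nat.strong_induction_on generalizing j h F r with | _ t ih => ?_
  rcases hA : A h with q | y
  · have hk : ∀ s ∈ cube bit F r, ∀ k ≤ j, ∀ x, A (transcript A (O s) k) ≠ Sum.inr x := by
      intro s hs k hk x hx
      rw [← transcript_eq_of_stopped hk hx, hh s hs, hA] at hx
      cases hx
    cases t with
    | zero =>
      have : cube bit F r ∩ {s | ∃ k ≤ j + 0, ∃ x ∈ G s, A (transcript A (O s) k) = Sum.inr x} =
          ∅ := by
        rw [eq_empty_iff_forall_notMem]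
        rintro s ⟨hs, k, hkj, x, -, hx⟩
        exact hk s hs k hkj x hx
      rw [this, ncard_empty, Nat.cast_zero]
      positivity
    | succ t =>
      rw [pow_succ']
      refine (hO q).ncard_inter_le (by positivity) (subset_univ _) fun F' r' hF hconst => ?_
      rw [show j + (t + 1) = j + 1 + t by ring]
      rcases (cube bit F' r').eq_empty_or_nonempty with he | ⟨s₀, hs₀⟩
      · rw [he, empty_inter, ncard_empty, Nat.cast_zero]
        positivity
      · refine ih t (Nat.lt_succ_self t) (j + 1) (h ++ [(q, O s₀ q)]) F' r' fun s hs => ?_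
        rw [transcript, hh s (hF hs), hA]
        simp only [hconst s hs s₀ hs₀]
  · have h1 : ∀ s ∈ cube bit F r, ∀ k, ∀ x, A (transcript A (O s) k) = Sum.inr x → x = y := by
      intro s hs k x hx
      have hj : A (transcript A (O s) j) = Sum.inr y := by rw [hh s hs, hA]
      rcases le_total j k with hjk | hjk
      · rw [transcript_eq_of_stopped hjk hj, hj] at hx
        exact (Sum.inr_injective hx).symm
      · rw [← transcript_eq_of_stopped hjk hx, hj] at hx
        exact (Sum.inr_injective hx).symm
    refine le_trans ?_ (one_le_mul_of_one_le_of_one_le (one_le_pow₀ (by norm_num))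
      (one_le_pow₀ (by norm_num)))
    norm_cast
    rw [ncard_le_one (toFinite _)]
    rintro s ⟨hs, k, -, x, hx, hxs⟩ s' ⟨hs', k', -, x', hx', hxs'⟩
    rw [h1 s hs k x hxs] at hx
    rw [h1 s' hs' k' x' hxs'] at hx'
    exact hG s s' y hx hx'

end GuessChain
/-! ### From counting to complexity bounds -/

section Complexity

variable {I P Y Q : Type*} {bit : I → P → Bool}

/-- Up to the first stop every step adds one entry to the transcript, so the time of this stop is at
most the number of queries. -/
lemma exists_stop_le_of_queryCount_lt {A : Algorithm Q Y} {o : Q → Y} {G : Set Q} {t : ℕ}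
    (hs : Succeeds A o G) (ht : queryCount A o < (t + 1 : ℕ)) :
    ∃ k ≤ t, ∃ x ∈ G, A (transcript A o k) = Sum.inr x := by
  classical
  have hk := Nat.find_spec hs
  have hmin : ∀ j < Nat.find hs, ∃ q, A (transcript A o j) = Sum.inl q := by
    intro j hj
    rcases h : A (transcript A o j) with q | y
    · exact ⟨q, rfl⟩
    · obtain ⟨x, hx, hAx⟩ := hk
      rw [transcript_eq_of_stopped hj.le h, h] at hAx
      exact absurd ⟨x, hx, by rw [h, hAx]⟩ (Nat.find_min hs hj)
  have hlen : ∀ j ≤ Nat.find hs, (transcript A o j).length = j := by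
    intro j
    induction j with
    | zero => intro _; rfl
    | succ j ih =>
      intro hj
      obtain ⟨q, hq⟩ := hmin j hj
      rw [transcript, hq]
      simp [ih (by omega)]
  refine ⟨Nat.find hs, ?_, hk⟩
  have h1 : ((Nat.find hs : ℕ) : ℝ≥0∞) ≤ queryCount A o := by
    conv_lhs => rw [← hlen _ le_rfl]
    exact le_iSup (fun t : ℕ => ((transcript A o t).length : ℝ≥0∞)) _
  have h2 := h1.trans_lt ht
  rw [Nat.cast_lt] at h2
  omega

variable [Fintype I] [Fintype P] {O : I → Q → Y} {G : I → Set Q}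

lemma sum_law_succeeds_le (hO : ∀ x, GuessChain bit (fun s => O s x) univ)
    (hG : ∀ s t x, x ∈ G s → x ∈ G t → s = t) (A : RandAlgorithm O G) (t : ℕ) :
    ∑ s, A.law ({ω | Succeeds (A.alg ω) (O s) (G s)} ∩
      {ω | queryCount (A.alg ω) (O s) < (t + 1 : ℕ)}) ≤
      ENNReal.ofReal (2 ^ t * (3 / 2) ^ Fintype.card P) := by
  classical
  set E : I → Set A.Seed := fun s => {ω | Succeeds (A.alg ω) (O s) (G s)} ∩
      {ω | queryCount (A.alg ω) (O s) < (t + 1 : ℕ)} with hE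
  have hmeas : ∀ s, MeasurableSet (E s) := fun s =>
    (A.measurableSet_succeeds s).inter (measurableSet_lt (A.measurable_queryCount s)
      measurable_const)
  -- For a fixed seed the sum of indicators counts the instances solved by a deterministic
  -- algorithm, so the counting bound holds under the integral.
  calc ∑ s, A.law (E s) = ∫⁻ ω, ∑ s, (E s).indicator 1 ω ∂A.law := by
        rw [MeasureTheory.lintegral_finsetSum _ fun s _ => measurable_one.indicator (hmeas s)]
        exact Finset.sum_congr rfl fun s _ => (MeasureTheory.lintegral_indicator_one (hmeas s)).symm
    _ ≤ ∫⁻ _, ENNReal.ofReal (2 ^ t * (3 / 2) ^ Fintype.card P) ∂A.law := by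
        refine MeasureTheory.lintegral_mono fun ω => ?_
        have hcount := ncard_cube_inter_le hO hG (A.alg ω) t 0 [] ∅ (fun _ => false)
          fun s _ => rfl
        rw [Finset.compl_empty, Finset.card_univ] at hcount
        have hsum : ∑ s, (E s).indicator (1 : A.Seed → ℝ≥0∞) ω =
            (({s | ω ∈ E s} : Set I).ncard : ℝ≥0∞) := by
          rw [← Finset.coe_filter_univ, ncard_coe_finset, Finset.card_filter]
          push_cast
          exact Finset.sum_congr rfl fun s _ => by simp [indicator_apply]
        rw [hsum, ← ENNReal.ofReal_natCast]
        refine ENNReal.ofReal_le_ofReal (le_trans ?_ hcount)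
        norm_cast
        refine ncard_le_ncard (fun s hs => ⟨by simp [cube], ?_⟩) (toFinite _)
        simpa using exists_stop_le_of_queryCount_lt hs.1 hs.2
    _ = _ := by simp

lemma successProb_le (hO : ∀ x, GuessChain bit (fun s => O s x) univ)
    (hG : ∀ s t x, x ∈ G s → x ∈ G t → s = t) (hI : Fintype.card I = 2 ^ Fintype.card P)
    (A : RandAlgorithm O G) :
    A.successProb ≤ A.probQueriesGE ((Fintype.card P / 4 + 1 : ℕ)) +
      ENNReal.ofReal ((9 / 10) ^ Fintype.card P) := by
  set m := Fintype.card P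
  -- The numbers fit because 2 ≤ (6/5)^4 and (6/5)(3/2) = (9/10)·2.
  have hreal : (2 : ℝ) ^ (m / 4) * (3 / 2) ^ m ≤ (9 / 10) ^ m * 2 ^ m := by
    have h1 : (2 : ℝ) ^ (m / 4) ≤ (6 / 5) ^ m :=
      calc (2 : ℝ) ^ (m / 4) ≤ ((6 / 5) ^ 4) ^ (m / 4) :=
            pow_le_pow_left₀ (by norm_num) (by norm_num) _
        _ = (6 / 5) ^ (4 * (m / 4)) := by rw [← pow_mul]
        _ ≤ (6 / 5) ^ m := pow_le_pow_right₀ (by norm_num) (Nat.mul_div_le m 4)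
    calc (2 : ℝ) ^ (m / 4) * (3 / 2) ^ m ≤ (6 / 5) ^ m * (3 / 2) ^ m := by gcongr
      _ = (9 / 10) ^ m * 2 ^ m := by rw [← mul_pow, ← mul_pow]; norm_num
  have hsum : ∑ s, A.law {ω | Succeeds (A.alg ω) (O s) (G s)} ≤
      (∑ s, A.law {ω | ((m / 4 + 1 : ℕ) : ℝ≥0∞) ≤ queryCount (A.alg ω) (O s)}) +
      ENNReal.ofReal ((9 / 10) ^ m * 2 ^ m) := by
    refine le_trans ?_ (add_le_add_right ((sum_law_succeeds_le hO hG A (m / 4)).trans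
      (ENNReal.ofReal_le_ofReal hreal)) _)
    rw [← Finset.sum_add_distrib]
    refine Finset.sum_le_sum fun s _ => ?_
    refine (MeasureTheory.measure_mono fun ω hω => ?_).trans (MeasureTheory.measure_union_le _ _)
    rcases le_or_gt ((m / 4 + 1 : ℕ) : ℝ≥0∞) (queryCount (A.alg ω) (O s)) with h | h
    · exact Or.inl h
    · exact Or.inr ⟨hω, h⟩
  have hcard : (Fintype.card I : ℝ≥0∞) = ENNReal.ofReal (2 ^ m) := by
    rw [hI, ENNReal.ofReal_pow zero_le_two]; simp
  have h2 : ENNReal.ofReal (2 ^ m) ≠ 0 := by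
    rw [Ne, ENNReal.ofReal_eq_zero, not_le]; positivity
  refine (ENNReal.div_le_div_right hsum _).trans_eq ?_
  rw [ENNReal.add_div, RandAlgorithm.probQueriesGE]
  congr 1
  rw [hcard, ENNReal.ofReal_mul (by positivity), ENNReal.mul_div_cancel_right h2
    ENNReal.ofReal_ne_top]

omit [Fintype P] in
lemma mul_probQueriesGE_le (A : RandAlgorithm O G) (τ : ℝ≥0∞) :
    τ * A.probQueriesGE τ ≤ A.expectedQueries := by
  rw [RandAlgorithm.probQueriesGE, RandAlgorithm.expectedQueries, ← mul_div_assoc, Finset.mul_sum]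
  refine ENNReal.div_le_div_right (Finset.sum_le_sum fun s _ => ?_) _
  exact MeasureTheory.mul_meas_ge_le_lintegral (A.measurable_queryCount s) τ

lemma ofReal_le_probQueriesGE (hO : ∀ x, GuessChain bit (fun s => O s x) univ)
    (hG : ∀ s t x, x ∈ G s → x ∈ G t → s = t) (hI : Fintype.card I = 2 ^ Fintype.card P)
    {A : RandAlgorithm O G} {Pe δ : ℝ} (hA : ENNReal.ofReal (1 - Pe) ≤ A.successProb)
    (hδ : (9 / 10) ^ Fintype.card P ≤ δ) :
    ENNReal.ofReal (1 - Pe - δ) ≤ A.probQueriesGE ((Fintype.card P / 4 + 1 : ℕ)) := by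
  have h := hA.trans (successProb_le hO hG hI A)
  refine (ENNReal.ofReal_le_ofReal (sub_le_sub_left hδ _)).trans ?_
  rw [ENNReal.ofReal_sub _ (by positivity)]
  exact tsub_le_iff_right.2 h

lemma le_highProbComplexity (hO : ∀ x, GuessChain bit (fun s => O s x) univ)
    (hG : ∀ s t x, x ∈ G s → x ∈ G t → s = t) (hI : Fintype.card I = 2 ^ Fintype.card P)
    {Pe δ : ℝ} (hδ : (9 / 10) ^ Fintype.card P ≤ δ) :
    ENNReal.ofReal (Fintype.card P / 4) ≤ highProbComplexity O G Pe δ := by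
  refine le_iInf₂ fun A hA => le_trans ?_ (le_sSup (ofReal_le_probQueriesGE hO hG hI hA hδ))
  rw [← ENNReal.ofReal_natCast]
  refine ENNReal.ofReal_le_ofReal ?_
  -- The extra 1 in the threshold makes up for the rounding in the natural-number division.
  rw [div_le_iff₀ (by norm_num)]
  norm_cast
  omega

lemma le_distComplexity (hO : ∀ x, GuessChain bit (fun s => O s x) univ)
    (hG : ∀ s t x, x ∈ G s → x ∈ G t → s = t) (hI : Fintype.card I = 2 ^ Fintype.card P)
    (Pe : ℝ) :
    ENNReal.ofReal (Fintype.card P / 4 * (1 - Pe - (9 / 10) ^ Fintype.card P)) ≤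
      distComplexity O G Pe := by
  refine le_iInf₂ fun A hA => le_trans ?_ (mul_probQueriesGE_le A ((Fintype.card P / 4 + 1 : ℕ)))
  rw [ENNReal.ofReal_mul (by positivity)]
  refine mul_le_mul' ?_ (ofReal_le_probQueriesGE hO hG hI hA le_rfl)
  rw [← ENNReal.ofReal_natCast]
  refine ENNReal.ofReal_le_ofReal ?_
  rw [div_le_iff₀ (by norm_num)]
  norm_cast
  omega

end Complexity

/-! ### A maximum of functions of independent strings -/

lemma exists_least_argmax {n : ℕ} [NeZero n] (v : Fin n → ℝ) :
    ∃ i, (∀ j, v j ≤ v i) ∧ ∀ j < i, v j < v i := by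
  obtain ⟨i₀, hi₀⟩ := Finite.exists_max v
  obtain ⟨i, hi⟩ := (wellFounded_lt (α := Fin n)).has_min {i | ∀ j, v j ≤ v i} ⟨i₀, hi₀⟩
  refine ⟨i, hi.1, fun j hj => lt_of_le_of_ne (hi.1 j) fun he => hi.2 j ?_ hj⟩
  intro k
  rw [he]
  exact hi.1 k

/-- The strings `s` and `r` have the same first `d` bits. -/
def AgreeBelow {M : ℕ} (d : ℕ) (s r : Fin M → Bool) : Prop := ∀ k : Fin M, k < d → s k = r k

/-- If, whenever a prefix of the `i`-th string is known, the value `g i` either is known or has a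
known upper bound that is attained for one value of the next bit, then the maximum of the `g i` is
found by guessing bits until the first wrong guess. -/
lemma guessChain_of_max {n M : ℕ} [NeZero n] {Y Z : Type*} {g : Fin n → (Fin M → Bool) → ℝ × Z}
    {a : (Fin n → Fin M → Bool) → Y}
    (hg : ∀ i r d, d ≤ M → ∃ y : ℝ × Z, (∀ s, AgreeBelow d s r → (g i s).1 ≤ y.1) ∧
      ((∀ s, AgreeBelow d s r → g i s = y) ∨
        ∃ (hd : d < M) (b : Bool), ∀ s, AgreeBelow d s r → s ⟨d, hd⟩ = b → g i s = y))
    (ha : ∀ s t i, (∀ j, (g j (s j)).1 ≤ (g i (s i)).1) → (∀ j < i, (g j (s j)).1 < (g i (s i)).1) →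
      (∀ j, (g j (t j)).1 ≤ (g i (t i)).1) → (∀ j < i, (g j (t j)).1 < (g i (t i)).1) →
      g i (s i) = g i (t i) → a s = a t) (N : ℕ) (r : Fin n → Fin M → Bool)
    (d : Fin n → ℕ) (hd : ∀ i, d i ≤ M) (hN : ∑ i, (M - d i) ≤ N) :
    GuessChain (fun (s : Fin n → Fin M → Bool) (p : Fin n × Fin M) => s p.1 p.2) a
      {s | ∀ i, AgreeBelow (d i) (s i) (r i)} := by
  induction N using Nat.strong_induction_on generalizing r d with | _ N ih => ?_
  choose y hy hy' using fun i => hg i (r i) (d i) (hd i)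
  -- If the bound at this i is attained, then i is the least active coordinate, whatever the unknown
  -- bits of the other strings are.
  obtain ⟨i, hi, hi'⟩ := exists_least_argmax fun i => (y i).1
  have hconst : ∀ s ∈ {s : Fin n → Fin M → Bool | ∀ i, AgreeBelow (d i) (s i) (r i)},
      ∀ t ∈ {s : Fin n → Fin M → Bool | ∀ i, AgreeBelow (d i) (s i) (r i)},
      g i (s i) = y i → g i (t i) = y i → a s = a t := by
    intro s hs t ht hsi hti
    refine ha s t i ?_ ?_ ?_ ?_ (hsi.trans hti.symm)
    · intro j; rw [hsi]; exact (hy j _ (hs j)).trans (hi j)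
    · intro j hj; rw [hsi]; exact (hy j _ (hs j)).trans_lt (hi' j hj)
    · intro j; rw [hti]; exact (hy j _ (ht j)).trans (hi j)
    · intro j hj; rw [hti]; exact (hy j _ (ht j)).trans_lt (hi' j hj)
  rcases hy' i with h | ⟨hdi, b, h⟩
  · exact .const fun s hs t ht => hconst s hs t ht (h _ (hs i)) (h _ (ht i))
  -- The guess is the opposite of the exit bit: a wrong guess means that the bound is attained.
  · refine .guess (i, ⟨d i, hdi⟩) (!b) (fun s hs t ht hsb htb => ?_) ?_
    · exact hconst s hs t ht (h _ (hs i) (by simpa using hsb)) (h _ (ht i) (by simpa using htb))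
    · have hlt : ∑ j, (M - Function.update d i (d i + 1) j) < N := by
        refine lt_of_lt_of_le (Finset.sum_lt_sum (fun j _ => ?_) ⟨i, Finset.mem_univ i, ?_⟩) hN
        · rcases eq_or_ne j i with rfl | hj
          · rw [Function.update_self]; omega
          · rw [Function.update_of_ne hj]
        · rw [Function.update_self]; omega
      refine (ih _ hlt (Function.update r i (Function.update (r i) ⟨d i, hdi⟩ (!b)))
        (Function.update d i (d i + 1)) ?_ le_rfl).mono ?_
      · intro j
        rcases eq_or_ne j i with rfl | hj
        · rw [Function.update_self]; omega
        · rw [Function.update_of_ne hj]; exact hd j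
      · rintro s ⟨hs, hsb⟩ j
        rcases eq_or_ne j i with rfl | hj
        · simp only [Function.update_self]
          intro k hk
          rcases eq_or_ne k ⟨d j, hdi⟩ with rfl | hk'
          · rw [Function.update_self]; exact hsb
          · rw [Function.update_of_ne hk']
            refine hs j k ?_
            have : (k : ℕ) ≠ d j := fun h => hk' (Fin.ext h)
            omega
        · simp only [Function.update_of_ne hj]
          exact hs j

/-! ### Slopes of the one-dimensional functions -/

/-- The left derivative if it is negative, otherwise the right derivative. -/
noncomputable def steepSlope (f : ℝ → ℝ) (z : ℝ) : ℝ :=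
  if derivWithin f (Iio z) z < 0 then derivWithin f (Iio z) z else derivWithin f (Ioi z) z

section Convex

variable {f : ℝ → ℝ} (hf : ConvexOn ℝ univ f)

include hf

lemma leftDeriv_le_rightDeriv (z : ℝ) :
    derivWithin f (Iio z) z ≤ derivWithin f (Ioi z) z :=
  hf.leftDeriv_le_rightDeriv_of_mem_interior (by simp)

lemma slope_le_leftDeriv {y z : ℝ} (h : y < z) :
    (f z - f y) / (z - y) ≤ derivWithin f (Iio z) z := by
  rw [← slope_def_field]
  exact hf.slope_le_leftDeriv_of_mem_interior (mem_univ y) (by simp) h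

lemma rightDeriv_le_slope {y z : ℝ} (h : z < y) :
    derivWithin f (Ioi z) z ≤ (f y - f z) / (y - z) := by
  rw [← slope_def_field]
  exact hf.rightDeriv_le_slope_of_mem_interior (by simp) (mem_univ y) h

lemma add_mul_le_of_mem_Icc {z c : ℝ}
    (hc : c ∈ Icc (derivWithin f (Iio z) z) (derivWithin f (Ioi z) z)) (y : ℝ) :
    f z + c * (y - z) ≤ f y := by
  rcases lt_trichotomy y z with h | rfl | h
  · have := (slope_le_leftDeriv hf h).trans hc.1
    rw [div_le_iff₀ (by linarith)] at this
    linarith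
  · simp
  · have := hc.2.trans (rightDeriv_le_slope hf h)
    rw [le_div_iff₀ (by linarith)] at this
    linarith

lemma add_steepSlope_mul_le (z y : ℝ) : f z + steepSlope f z * (y - z) ≤ f y := by
  refine add_mul_le_of_mem_Icc hf ?_ y
  rw [steepSlope]
  split_ifs
  · exact ⟨le_rfl, leftDeriv_le_rightDeriv hf z⟩
  · exact ⟨leftDeriv_le_rightDeriv hf z, le_rfl⟩

/-- A subgradient inequality on s alone suffices, since the one-sided derivatives at an interior
point are extremal difference quotients over s. -/
lemma mem_Icc_of_add_mul_le {z c : ℝ} {s : Set ℝ} (hs : Convex ℝ s) (hz : z ∈ interior s)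
    (hc : ∀ y ∈ s, f z + c * (y - z) ≤ f y) :
    c ∈ Icc (derivWithin f (Iio z) z) (derivWithin f (Ioi z) z) := by
  have hfs := hf.subset (subset_univ s) hs
  obtain ⟨a, b, hab, hsub⟩ := mem_nhds_iff_exists_Ioo_subset.1 (mem_interior_iff_mem_nhds.1 hz)
  obtain ⟨p, hap, hpz⟩ := exists_between hab.1
  obtain ⟨q, hzq, hqb⟩ := exists_between hab.2
  rw [hfs.rightDeriv_eq_sInf_slope_of_mem_interior hz, hfs.leftDeriv_eq_sSup_slope_of_mem_interior hz]
  constructor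
  · refine csSup_le ⟨_, mem_image_of_mem _ ⟨hsub ⟨hap, hpz.trans hab.2⟩, hpz⟩⟩ ?_
    rintro _ ⟨y, ⟨hy, hyz⟩, rfl⟩
    have := hc y hy
    rw [slope_comm, slope_def_field, div_le_iff₀ (by linarith)]
    linarith
  · refine le_csInf ⟨_, mem_image_of_mem _ ⟨hsub ⟨hab.1.trans hzq, hqb⟩, hzq⟩⟩ ?_
    rintro _ ⟨y, ⟨hy, hyz⟩, rfl⟩
    have := hc y hy
    rw [slope_def_field, le_div_iff₀ (by linarith)]
    linarith

/-- Convex functions whose steep slopes at an interior point are subgradients of each other have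
the same steep slope there. -/
lemma steepSlope_eq_steepSlope {g : ℝ → ℝ} (hg : ConvexOn ℝ univ g) {z : ℝ} {s : Set ℝ}
    (hs : Convex ℝ s) (hz : z ∈ interior s)
    (hfg : ∀ y ∈ s, g z + steepSlope f z * (y - z) ≤ g y)
    (hgf : ∀ y ∈ s, f z + steepSlope g z * (y - z) ≤ f y) : steepSlope f z = steepSlope g z := by
  obtain ⟨h1, h2⟩ := mem_Icc_of_add_mul_le hg hs hz hfg
  obtain ⟨h3, h4⟩ := mem_Icc_of_add_mul_le hf hs hz hgf
  have h5 := leftDeriv_le_rightDeriv hf z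
  have h6 := leftDeriv_le_rightDeriv hg z
  -- Each steep slope lies between the one-sided derivatives of the other function. So the left
  -- derivatives are negative together and then equal; otherwise the same comparison applies to the
  -- right derivatives.
  simp only [steepSlope] at *
  split_ifs at * <;> linarith

end Convex

lemma leftDeriv_nestedFn_neg {u : List Bool} {z : ℝ} (h : z < center u) :
    derivWithin (nestedFn u) (Iio z) z < 0 := by
  have hf := convexOn_nestedFn u
  refine (leftDeriv_le_rightDeriv hf z).trans_lt ((rightDeriv_le_slope hf h).trans_lt ?_)
  refine div_neg_of_neg_of_pos (sub_neg.2 ?_) (sub_pos.2 h)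
  rw [nestedFn_center]
  refine lt_of_lt_of_le ?_ (vee_le_nestedFn u z)
  rw [vee_eq, minValue, lt_add_iff_pos_right]
  have : 0 < |z - center u| := abs_pos.2 (sub_ne_zero.2 h.ne)
  positivity

lemma leftDeriv_nestedFn_nonneg {u : List Bool} {z : ℝ} (h : center u < z) :
    0 ≤ derivWithin (nestedFn u) (Iio z) z := by
  refine le_trans ?_ (slope_le_leftDeriv (convexOn_nestedFn u) h)
  refine div_nonneg (sub_nonneg.2 ?_) (sub_nonneg.2 h.le)
  rw [nestedFn_center]
  exact minValue_le_nestedFn u z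

lemma abs_coord_center_append_lt_one (u w : List Bool) : |coord u (center (u ++ w))| < 1 :=
  abs_coord_lt_one_of_append w (by simp [coord_center])

/-- Outside the interior of `I_u` neither the value nor the steep slope depends on the bits
after `u`. -/
lemma steepSlope_nestedFn_append {u : List Bool} (w : List Bool) {z : ℝ} (h : 1 ≤ |coord u z|) :
    steepSlope (nestedFn (u ++ w)) z = steepSlope (nestedFn u) z := by
  have hw := abs_lt.1 (abs_coord_center_append_lt_one u w)
  have hu : coord u (center u) = 0 := coord_center u
  -- Every possible minimum point lies inside I_u. To its left the left derivative is negative and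
  -- is used; to its right the right derivative is used. Either way only points outside the interior
  -- of I_u matter, even when z is an endpoint.
  rcases le_abs'.1 h with hz | hz
  · have heq : ∀ y ≤ z, nestedFn (u ++ w) y = nestedFn u y := fun y hy =>
      nestedFn_append_eq w (le_abs'.2 (Or.inl (((coord_le_coord_iff u y z).2 hy).trans hz)))
    have hd : derivWithin (nestedFn (u ++ w)) (Iio z) z = derivWithin (nestedFn u) (Iio z) z :=
      derivWithin_congr (fun y hy => heq y (le_of_lt hy)) (heq z le_rfl)
    rw [steepSlope, steepSlope, if_pos, if_pos, hd]
    · exact leftDeriv_nestedFn_neg ((coord_lt_coord_iff u _ _).1 (by linarith))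
    · exact leftDeriv_nestedFn_neg ((coord_lt_coord_iff u _ _).1 (by linarith))
  · have heq : ∀ y, z ≤ y → nestedFn (u ++ w) y = nestedFn u y := fun y hy =>
      nestedFn_append_eq w (le_abs'.2 (Or.inr (hz.trans ((coord_le_coord_iff u z y).2 hy))))
    have hd : derivWithin (nestedFn (u ++ w)) (Ioi z) z = derivWithin (nestedFn u) (Ioi z) z :=
      derivWithin_congr (fun y hy => heq y (le_of_lt hy)) (heq z le_rfl)
    rw [steepSlope, steepSlope, if_neg, if_neg, hd]
    · exact (leftDeriv_nestedFn_nonneg ((coord_lt_coord_iff u _ _).1 (by linarith))).not_gt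
    · exact (leftDeriv_nestedFn_nonneg ((coord_lt_coord_iff u _ _).1 (by linarith))).not_gt

/-- Value and steep slope at a point are found by guessing bits from the first on. -/
lemma nestedFn_known_or_exit_bit {M : ℕ} (z : ℝ) (r : Fin M → Bool) (d : ℕ) (hd : d ≤ M) :
    ∃ y : ℝ × ℝ, (∀ s, AgreeBelow d s r → nestedFn (List.ofFn s) z ≤ y.1) ∧
      ((∀ s : Fin M → Bool, AgreeBelow d s r →
          (nestedFn (List.ofFn s) z, steepSlope (nestedFn (List.ofFn s)) z) = y) ∨
        ∃ (hd : d < M) (b : Bool), ∀ s, AgreeBelow d s r → s ⟨d, hd⟩ = b →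
          (nestedFn (List.ofFn s) z, steepSlope (nestedFn (List.ofFn s)) z) = y) := by
  set u := (List.ofFn r).take d with hu
  have htake : ∀ s, AgreeBelow d s r → (List.ofFn s).take d = u := by
    intro s hs
    refine List.ext_getElem (by simp [hu]) fun k hk _ => ?_
    simp only [List.length_take, List.length_ofFn, lt_inf_iff] at hk
    simpa [hu] using hs ⟨k, hk.2⟩ hk.1
  have happ : ∀ s, AgreeBelow d s r → ∃ w, List.ofFn s = u ++ w := fun s hs =>
    ⟨(List.ofFn s).drop d, by rw [← htake s hs, List.take_append_drop]⟩
  rcases le_or_gt 1 |coord u z| with h | h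
  · refine ⟨(nestedFn u z, steepSlope (nestedFn u) z), fun s hs => ?_, Or.inl fun s hs => ?_⟩
    · obtain ⟨w, hw⟩ := happ s hs
      rw [hw, nestedFn_append_eq w h]
    · obtain ⟨w, hw⟩ := happ s hs
      rw [hw, nestedFn_append_eq w h, steepSlope_nestedFn_append w h]
  · rcases hd.eq_or_lt with rfl | hdM
    · have heq : ∀ s, AgreeBelow d s r → s = r := fun s hs => funext fun k => hs k k.2
      refine ⟨_, fun s hs => ?_, Or.inl fun s hs => by rw [heq s hs]⟩
      rw [heq s hs]
    · obtain ⟨b, hb, hle⟩ := exists_exit_bit h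
      refine ⟨(nestedFn (u ++ [b]) z, steepSlope (nestedFn (u ++ [b])) z), fun s hs => ?_,
        Or.inr ⟨hdM, b, fun s hs hsb => ?_⟩⟩
      · obtain ⟨w, hw⟩ := happ s hs
        rw [hw]
        exact hle w
      · have hw : List.ofFn s = (u ++ [b]) ++ (List.ofFn s).drop (d + 1) := by
          have h1 : (List.ofFn s).take (d + 1) = u ++ [b] := by
            rw [List.take_succ_eq_append_getElem (by simpa using hdM), htake s hs]
            simp [hsb]
          rw [← h1, List.take_append_drop]
        rw [hw, nestedFn_append_eq _ hb, steepSlope_nestedFn_append _ hb]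

/-! ### The functions on the box -/

lemma mem_box_iff {n : ℕ} {R : ℝ} (hR : 0 ≤ R) {x : Fin n → ℝ} :
    x ∈ box n R ↔ ∀ i, |x i| ≤ R := by
  rw [mem_closedBall_zero_iff, pi_norm_le_iff_of_nonneg hR]
  rfl

/-- Subgradients of a convex function are determined by the function near the point. -/
lemma IsSubgradient.congr {n : ℕ} {X : Set (Fin n → ℝ)} {f f' : (Fin n → ℝ) → ℝ}
    {x g : Fin n → ℝ} (h : IsSubgradient X f x g) (hx : x ∈ X) (hf' : ConvexOn ℝ X f')
    (hff' : f =ᶠ[𝓝[X] x] f') : IsSubgradient X f' x g := by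
  intro y hy
  -- Near x on the segment to y the functions agree; convexity carries the inequality on to y.
  have htend : Tendsto (fun e : ℝ => x + e • (y - x)) (𝓝[Ioc 0 1] 0) (𝓝[X] x) := by
    refine tendsto_nhdsWithin_iff.2 ⟨?_, ?_⟩
    · have : Continuous fun e : ℝ => x + e • (y - x) := by fun_prop
      exact (this.tendsto' 0 x (by simp)).mono_left nhdsWithin_le_nhds
    · filter_upwards [self_mem_nhdsWithin] with e he
      exact hf'.1.add_smul_sub_mem hx hy ⟨he.1.le, he.2⟩
  have hne : (𝓝[Ioc (0 : ℝ) 1] 0).NeBot := by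
    rw [nhdsWithin_Ioc_eq_nhdsGT one_pos]; infer_instance
  obtain ⟨e, he, he01⟩ := ((htend.eventually hff').and self_mem_nhdsWithin).exists
  have hmem : x + e • (y - x) ∈ X := hf'.1.add_smul_sub_mem hx hy ⟨he01.1.le, he01.2⟩
  have h1 := h _ hmem
  rw [he, hff'.eq_of_nhdsWithin hx, add_sub_cancel_left, dotProduct_smul, smul_eq_mul] at h1
  have h2 := hf'.2 hx hy (sub_nonneg.2 he01.2) he01.1.le (sub_add_cancel 1 e)
  rw [show (1 - e) • x + e • y = x + e • (y - x) by module] at h2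
  simp only [smul_eq_mul] at h2
  have h3 : e * (f' x + g ⬝ᵥ (y - x)) ≤ e * f' y := by linarith
  exact le_of_mul_le_mul_left h3 he01.1

section BoxFn

variable {n M : ℕ} [NeZero n] {L R : ℝ}

/-- The values in the maximum that defines the members of the family. -/
noncomputable def coordValue (R : ℝ) (s : Fin n → Fin M → Bool) (x : Fin n → ℝ) (i : Fin n) : ℝ :=
  nestedFn (List.ofFn (s i)) (x i / R)

/-- The least coordinate at which the maximum is attained. -/
noncomputable def activeIndex (v : Fin n → ℝ) : Fin n := (exists_least_argmax v).choose

lemma le_activeIndex (v : Fin n → ℝ) (j : Fin n) : v j ≤ v (activeIndex v) :=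
  (exists_least_argmax v).choose_spec.1 j

lemma lt_of_lt_activeIndex (v : Fin n → ℝ) {j : Fin n} (h : j < activeIndex v) :
    v j < v (activeIndex v) :=
  (exists_least_argmax v).choose_spec.2 j h

lemma activeIndex_eq {v : Fin n → ℝ} {i : Fin n} (h : ∀ j, v j ≤ v i) (h' : ∀ j < i, v j < v i) :
    activeIndex v = i := by
  rcases lt_trichotomy (activeIndex v) i with hi | hi | hi
  · exact absurd (h' _ hi) (le_activeIndex v i).not_gt
  · exact hi
  · exact absurd (lt_of_lt_activeIndex v hi) (h _).not_gt

lemma boxFn_eq {s : Fin n → Fin M → Bool} {x : Fin n → ℝ} {i : Fin n}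
    (h : ∀ j, coordValue R s x j ≤ coordValue R s x i) :
    boxFn n M L R s x = L * R * coordValue R s x i := by
  rw [boxFn]
  congr 1
  exact le_antisymm (ciSup_le h) (le_ciSup (f := coordValue R s x) (finite_range _).bddAbove i)

lemma boxFn_eq_activeIndex (s : Fin n → Fin M → Bool) (x : Fin n → ℝ) :
    boxFn n M L R s x = L * R * coordValue R s x (activeIndex (coordValue R s x)) :=
  boxFn_eq (le_activeIndex _)

lemma mul_coordValue_le_boxFn (hL : 0 < L) (hR : 0 < R) (s : Fin n → Fin M → Bool)
    (x : Fin n → ℝ) (i : Fin n) : L * R * coordValue R s x i ≤ boxFn n M L R s x := by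
  rw [boxFn_eq_activeIndex]
  have := le_activeIndex (coordValue R s x) i
  gcongr

omit [NeZero n] in
lemma minValue_le_coordValue (s : Fin n → Fin M → Bool) (x : Fin n → ℝ) (i : Fin n) :
    minValue M ≤ coordValue R s x i := by
  simpa [coordValue] using minValue_le_nestedFn (List.ofFn (s i)) (x i / R)

/-- The minimum point of a member of the family. -/
noncomputable def minPoint (R : ℝ) (s : Fin n → Fin M → Bool) (i : Fin n) : ℝ :=
  R * center (List.ofFn (s i))

omit [NeZero n] in
lemma coordValue_update_minPoint (hR : 0 < R) (s : Fin n → Fin M → Bool) (i : Fin n) (z : ℝ)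
    (j : Fin n) : coordValue R s (Function.update (minPoint R s) i z) j =
      if j = i then nestedFn (List.ofFn (s i)) (z / R) else minValue M := by
  split_ifs with h
  · subst h; rw [coordValue, Function.update_self]
  · rw [coordValue, Function.update_of_ne h, minPoint, mul_div_cancel_left₀ _ hR.ne',
      nestedFn_center, List.length_ofFn]

/-- All one-dimensional functions have the same minimum, so coordinates at their minimum points
never exceed the remaining one. This isolates a single coordinate. -/
lemma boxFn_update_minPoint (hR : 0 < R) (s : Fin n → Fin M → Bool) (i : Fin n) (z : ℝ) :
    boxFn n M L R s (Function.update (minPoint R s) i z) =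
      L * R * nestedFn (List.ofFn (s i)) (z / R) := by
  rw [boxFn_eq (i := i)]
  · rw [coordValue_update_minPoint hR, if_pos rfl]
  · intro j
    rw [coordValue_update_minPoint hR s i z i, if_pos rfl, coordValue_update_minPoint hR]
    split_ifs
    · exact le_rfl
    · simpa using minValue_le_nestedFn (List.ofFn (s i)) (z / R)

omit [NeZero n] in
lemma update_minPoint_mem_box (hR : 0 < R) (s : Fin n → Fin M → Bool) (i : Fin n) {z : ℝ}
    (hz : |z| ≤ R) : Function.update (minPoint R s) i z ∈ box n R := by
  rw [mem_box_iff hR.le]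
  intro j
  rcases eq_or_ne j i with rfl | h
  · rwa [Function.update_self]
  · rw [Function.update_of_ne h, minPoint, abs_mul, abs_of_pos hR]
    exact mul_le_of_le_one_right hR.le (abs_center_le_one _)

omit [NeZero n] in
lemma minPoint_mem_box (hR : 0 < R) (s : Fin n → Fin M → Bool) : minPoint R s ∈ box n R := by
  rw [mem_box_iff hR.le]
  intro j
  rw [minPoint, abs_mul, abs_of_pos hR]
  exact mul_le_of_le_one_right hR.le (abs_center_le_one _)

lemma boxFn_minPoint (hR : 0 < R) (s : Fin n → Fin M → Bool) :
    boxFn n M L R s (minPoint R s) = L * R * minValue M := by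
  have h := boxFn_update_minPoint (L := L) hR s 0 (minPoint R s 0)
  rwa [Function.update_eq_self, minPoint, mul_div_cancel_left₀ _ hR.ne', nestedFn_center,
    List.length_ofFn] at h

lemma mul_minValue_le_boxFn (hL : 0 < L) (hR : 0 < R) (s : Fin n → Fin M → Bool)
    (x : Fin n → ℝ) : L * R * minValue M ≤ boxFn n M L R s x := by
  refine le_trans ?_ (mul_coordValue_le_boxFn hL hR s x 0)
  have := minValue_le_coordValue (R := R) s x 0
  gcongr

lemma convexOn_boxFn (hL : 0 < L) (hR : 0 < R) (s : Fin n → Fin M → Bool) :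
    ConvexOn ℝ (box n R) (boxFn n M L R s) := by
  refine ⟨convex_closedBall _ _, fun x _ y _ a b ha hb hab => ?_⟩
  rw [boxFn_eq_activeIndex]
  set i := activeIndex (coordValue R s (a • x + b • y))
  have h1 : coordValue R s (a • x + b • y) i ≤ a * coordValue R s x i + b * coordValue R s y i := by
    have := (convexOn_nestedFn (List.ofFn (s i))).2 (mem_univ (x i / R)) (mem_univ (y i / R))
      ha hb hab
    rw [show a • (x i / R) + b • (y i / R) = (a • x + b • y) i / R by simp; ring] at this
    exact this
  have h2 := mul_le_mul_of_nonneg_left (mul_coordValue_le_boxFn hL hR s x i) ha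
  have h3 := mul_le_mul_of_nonneg_left (mul_coordValue_le_boxFn hL hR s y i) hb
  have h4 := mul_le_mul_of_nonneg_left h1 (mul_pos hL hR).le
  simp only [smul_eq_mul]
  linarith

lemma boxFn_le_add (hL : 0 < L) (hR : 0 < R) (s : Fin n → Fin M → Bool) (x y : Fin n → ℝ) :
    boxFn n M L R s x ≤ boxFn n M L R s y + L * ‖x - y‖ := by
  rw [boxFn_eq_activeIndex]
  set i := activeIndex (coordValue R s x)
  have h1 : coordValue R s x i ≤ coordValue R s y i + ‖x - y‖ / R := by
    have h2 := (le_abs_self _).trans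
      (abs_nestedFn_sub_le (List.ofFn (s i)) (x i / R) (y i / R))
    rw [← sub_div, abs_div, abs_of_pos hR] at h2
    have h3 : |x i - y i| ≤ ‖x - y‖ := norm_le_pi_norm (x - y) i
    have h4 : |x i - y i| / R ≤ ‖x - y‖ / R := by gcongr
    simp only [coordValue]
    linarith
  have h5 := mul_le_mul_of_nonneg_left h1 (mul_pos hL hR).le
  have h6 := mul_coordValue_le_boxFn hL hR s y i
  have h7 : L * R * (‖x - y‖ / R) = L * ‖x - y‖ := by field_simp
  linarith

lemma abs_boxFn_sub_le (hL : 0 < L) (hR : 0 < R) (s : Fin n → Fin M → Bool) (x y : Fin n → ℝ) :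
    |boxFn n M L R s x - boxFn n M L R s y| ≤ L * ‖x - y‖ := by
  rw [abs_sub_le_iff]
  have h1 := boxFn_le_add hL hR s x y
  have h2 := boxFn_le_add hL hR s y x
  rw [norm_sub_rev] at h2
  constructor <;> linarith

/-- A point whose value is close to the minimum determines the instance. -/
lemma eq_of_boxFn_lt (hL : 0 < L) (hR : 0 < R) {s t : Fin n → Fin M → Bool} {x : Fin n → ℝ}
    (hs : boxFn n M L R s x < L * R * breakpoint M)
    (ht : boxFn n M L R t x < L * R * breakpoint M) : s = t := by
  have key : ∀ s : Fin n → Fin M → Bool, boxFn n M L R s x < L * R * breakpoint M → ∀ i,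
      |coord (List.ofFn (s i)) (x i / R)| < 1 := by
    intro s hs i
    have h := (mul_coordValue_le_boxFn hL hR s x i).trans_lt hs
    have h' := lt_of_mul_lt_mul_left h (mul_pos hL hR).le
    exact abs_coord_lt_one_of_lt (by simpa [coordValue] using h')
  funext i
  exact List.ofFn_injective (eq_of_abs_coord_lt_one (by simp) (key s hs i) (key t ht i))

lemma minValue_lt_breakpoint (k : ℕ) : minValue k < breakpoint k := by
  rw [minValue, sub_lt_self_iff]; positivity

/-- The last vee has depth LR·8^(-M), so an error of at most this depth keeps the value below the
level that identifies the instance. -/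
lemma boxFn_lt_of_mem_epsMinima (hL : 0 < L) (hR : 0 < R) {ε : ℝ}
    (hε : ε ≤ L * R * (1 / 8) ^ M) {s : Fin n → Fin M → Bool} {x : box n R}
    (hx : x ∈ epsMinima n R ε (boxFn n M L R s)) : boxFn n M L R s x < L * R * breakpoint M := by
  have h : (⨅ y : box n R, boxFn n M L R s y) ≤ L * R * minValue M := by
    rw [← boxFn_minPoint hR s]
    refine ciInf_le (f := fun y : box n R => boxFn n M L R s y)
      ⟨L * R * minValue M, ?_⟩ ⟨minPoint R s, minPoint_mem_box hR s⟩
    rintro _ ⟨y, rfl⟩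
    exact mul_minValue_le_boxFn hL hR s y
  have h2 : boxFn n M L R s x < _ := hx.2
  have h3 : L * R * minValue M = L * R * breakpoint M - L * R * (1 / 8) ^ M := by
    rw [minValue]; ring
  linarith

/-! ### The oracle -/

/-- The oracle that answers with the steep slope in the least active coordinate. -/
noncomputable def steepOracle (n M : ℕ) [NeZero n] (L R : ℝ) (s : Fin n → Fin M → Bool)
    (x : box n R) : ℝ × (Fin n → ℝ) :=
  (boxFn n M L R s x, Pi.single (activeIndex (coordValue R s x))
    (L * steepSlope (nestedFn (List.ofFn (s (activeIndex (coordValue R s x)))))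
      ((x : Fin n → ℝ) (activeIndex (coordValue R s x)) / R)))

lemma isFirstOrder_steepOracle (hL : 0 < L) (hR : 0 < R) :
    IsFirstOrder (box n R) (boxFn n M L R) (steepOracle n M L R) := by
  refine fun s x => ⟨rfl, fun y _ => ?_⟩
  simp only [steepOracle, single_dotProduct, Pi.sub_apply]
  rw [boxFn_eq_activeIndex]
  set i := activeIndex (coordValue R s (x : Fin n → ℝ))
  refine le_trans ?_ (mul_coordValue_le_boxFn hL hR s y i)
  have h := mul_le_mul_of_nonneg_left (add_steepSlope_mul_le (convexOn_nestedFn (List.ofFn (s i)))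
    ((x : Fin n → ℝ) i / R) (y i / R)) (mul_pos hL hR).le
  refine le_of_eq_of_le ?_ h
  rw [coordValue]
  field_simp

lemma not_isSubgradient_of_lt_activeIndex (hL : 0 < L) (hR : 0 < R) (s : Fin n → Fin M → Bool)
    {x : Fin n → ℝ} (hx : x ∈ box n R) {j : Fin n} (hj : j < activeIndex (coordValue R s x))
    (b : ℝ) : ¬ IsSubgradient (box n R) (boxFn n M L R s) x (Pi.single j b) := by
  intro h
  -- The test point keeps the j-th coordinate of x, so the linear term vanishes; but its value is
  -- that of an inactive coordinate, smaller than the value at x.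
  have h1 := h _ (update_minPoint_mem_box hR s j ((mem_box_iff hR.le).1 hx j))
  rw [single_dotProduct, Pi.sub_apply, Function.update_self, sub_self, mul_zero, add_zero,
    boxFn_update_minPoint hR, boxFn_eq_activeIndex] at h1
  exact (lt_of_lt_activeIndex _ hj).not_ge (le_of_mul_le_mul_left h1 (mul_pos hL hR))

lemma isSingleCoordinate_steepOracle (hL : 0 < L) (hR : 0 < R) :
    IsSingleCoordinate (box n R) (boxFn n M L R) (steepOracle n M L R) := fun s x =>
  ⟨_, _, rfl, fun _ hj b => not_isSubgradient_of_lt_activeIndex hL hR s x.2 hj b⟩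

lemma add_mul_le_nestedFn_of_isSubgradient (hL : 0 < L) (hR : 0 < R) {s : Fin n → Fin M → Bool}
    {x : Fin n → ℝ} {c : ℝ} (h : IsSubgradient (box n R) (boxFn n M L R s) x
      (Pi.single (activeIndex (coordValue R s x)) (L * c))) {z : ℝ} (hz : z ∈ Icc (-1) 1) :
    coordValue R s x (activeIndex (coordValue R s x)) +
      c * (z - x (activeIndex (coordValue R s x)) / R) ≤
      nestedFn (List.ofFn (s (activeIndex (coordValue R s x)))) z := by
  have hzR : |R * z| ≤ R := by
    rw [abs_mul, abs_of_pos hR]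
    exact mul_le_of_le_one_right hR.le (abs_le.2 hz)
  have h1 := h _ (update_minPoint_mem_box hR s (activeIndex (coordValue R s x)) hzR)
  rw [single_dotProduct, Pi.sub_apply, Function.update_self, boxFn_update_minPoint hR,
    boxFn_eq_activeIndex, mul_div_cancel_left₀ _ hR.ne'] at h1
  refine le_of_mul_le_mul_left (le_of_eq_of_le ?_ h1) (mul_pos hL hR)
  field_simp

/-- Functions that agree near x on the box may still come from different one-dimensional functions.
But each of the two answers is a subgradient for both instances, which determines the coordinate
and, at interior points, the slope. -/
lemma isLocal_steepOracle (hL : 0 < L) (hR : 0 < R) :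
    IsLocal (box n R) (boxFn n M L R) (steepOracle n M L R) := by
  intro s t x hst
  have hval : boxFn n M L R s x = boxFn n M L R t x := hst.eq_of_nhdsWithin x.2
  have hs : IsSubgradient (box n R) (boxFn n M L R t) x (steepOracle n M L R s x).2 :=
    (isFirstOrder_steepOracle hL hR s x).2.congr x.2 (convexOn_boxFn hL hR t) hst
  have ht : IsSubgradient (box n R) (boxFn n M L R s) x (steepOracle n M L R t x).2 :=
    (isFirstOrder_steepOracle hL hR t x).2.congr x.2 (convexOn_boxFn hL hR s) hst.symm
  have hidx : activeIndex (coordValue R s x) = activeIndex (coordValue R t x) := by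
    rcases lt_trichotomy (activeIndex (coordValue R s x)) (activeIndex (coordValue R t x))
      with h | h | h
    · exact absurd hs (not_isSubgradient_of_lt_activeIndex hL hR t x.2 h _)
    · exact h
    · exact absurd ht (not_isSubgradient_of_lt_activeIndex hL hR s x.2 h _)
  refine Prod.ext hval ?_
  simp only [steepOracle] at hs ht ⊢
  rw [← hidx] at ht ⊢
  rw [hidx] at hs
  have hs' := fun z hz => add_mul_le_nestedFn_of_isSubgradient hL hR hs (z := z) hz
  have ht' := fun z hz => add_mul_le_nestedFn_of_isSubgradient hL hR ht (z := z) hz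
  rw [← hidx] at hs'
  set i := activeIndex (coordValue R s x)
  congr 2
  -- On the boundary one derivative may look outside the box, but there all one-dimensional
  -- functions have the steep slope of |x|.
  rcases le_or_gt 1 |(x : Fin n → ℝ) i / R| with hz | hz
  · have key := fun u => steepSlope_nestedFn_append (u := []) u hz
    simp only [List.nil_append] at key
    rw [key (List.ofFn (s i)), key (List.ofFn (t i))]
  · exact steepSlope_eq_steepSlope (convexOn_nestedFn _) (convexOn_nestedFn _) (convex_Icc (-1) 1)
      (by rw [interior_Icc]; exact abs_lt.1 hz) hs' ht'

lemma guessChain_steepOracle (x : box n R) :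
    GuessChain (fun (s : Fin n → Fin M → Bool) (p : Fin n × Fin M) => s p.1 p.2)
      (fun s => steepOracle n M L R s x) univ := by
  refine (guessChain_of_max (g := fun i r => (nestedFn (List.ofFn r) ((x : Fin n → ℝ) i / R),
    steepSlope (nestedFn (List.ofFn r)) ((x : Fin n → ℝ) i / R)))
    (fun i r d hd => nestedFn_known_or_exit_bit _ r d hd) ?_ _ (fun _ _ => false) (fun _ => 0)
    (fun _ => Nat.zero_le _) le_rfl).mono fun s _ i k hk => absurd hk (Nat.not_lt_zero _)
  intro s t i h1 h2 h3 h4 heq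
  have hs : activeIndex (coordValue R s x) = i := activeIndex_eq h1 h2
  have ht : activeIndex (coordValue R t x) = i := activeIndex_eq h3 h4
  rw [Prod.mk.injEq] at heq
  refine Prod.ext ?_ ?_
  · change boxFn n M L R s x = boxFn n M L R t x
    rw [boxFn_eq h1, boxFn_eq h3]
    exact congrArg _ heq.1
  · simp only [steepOracle]
    rw [hs, ht, heq.2]

end BoxFn

/-! ### The length of the strings -/

lemma three_le_logb {L R ε : ℝ} (hε : 0 < ε) (h : ε ≤ L * R / 8) :
    3 ≤ Real.logb 2 (L * R / ε) := by
  have h8 : 8 ≤ L * R / ε := by rw [le_div_iff₀ hε]; linarith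
  rw [Real.le_logb_iff_rpow_le one_lt_two (by linarith)]
  norm_num
  exact h8

lemma le_mul_pow_of_eq_stringLength {L R ε : ℝ} {M : ℕ} (hL : 0 < L) (hR : 0 < R) (hε : 0 < ε)
    (h : ε ≤ L * R / 8) (hM : M = stringLength L R ε) : ε ≤ L * R * (1 / 8) ^ M := by
  have h3 := three_le_logb hε h
  have hfl : (M : ℝ) ≤ Real.logb 2 (L * R / ε) / 3 := by
    rw [hM, stringLength]; exact Nat.floor_le (by linarith)
  have hpow : (2 : ℝ) ^ ((3 * M : ℕ) : ℝ) ≤ L * R / ε := by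
    rw [← Real.le_logb_iff_rpow_le one_lt_two (by positivity)]
    push_cast
    linarith
  rw [Real.rpow_natCast, pow_mul, le_div_iff₀ hε] at hpow
  norm_num at hpow
  rw [one_div, inv_pow, ← div_eq_mul_inv, le_div_iff₀ (by positivity)]
  linarith

lemma logb_le_of_eq_stringLength {L R ε : ℝ} {M : ℕ} (hε : 0 < ε)
    (h : ε ≤ L * R / 8) (hM : M = stringLength L R ε) : Real.logb 2 (L * R / ε) ≤ 6 * M := by
  have h3 := three_le_logb hε h
  have h1 : 1 ≤ M := by
    rw [hM, stringLength]
    exact Nat.le_floor (by push_cast; linarith)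
  have h1' : (1 : ℝ) ≤ M := by exact_mod_cast h1
  have hlt : Real.logb 2 (L * R / ε) / 3 < M + 1 := by
    rw [hM, stringLength]; exact Nat.lt_floor_add_one _
  -- As M ≥ 1, the logarithm is below 3(M + 1) ≤ 6M.
  linarith

end BoxLowerBound

/-! ### Choice of the constants and conclusion -/

theorem theorem4p2 :
    ∃ c : ℝ, 0 < c ∧ ∃ K : ℝ, 0 < K ∧ ∃ δ : ℝ → ℝ, Tendsto δ atTop (𝓝 0) ∧
      ∀ (n M : ℕ) (L R ε : ℝ), 1 ≤ n → 0 < L → 0 < R → 0 < ε → ε ≤ L * R / 8 →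
        M = stringLength L R ε →
        -- the family: pairwise distinct convex functions, `L`-Lipschitz in the sup norm
        (∀ s t : Fin n → Fin M → Bool,
          Set.EqOn (boxFn n M L R s) (boxFn n M L R t) (box n R) → s = t) ∧
        (∀ s : Fin n → Fin M → Bool,
          ConvexOn ℝ (box n R) (boxFn n M L R s) ∧
          ∀ x ∈ box n R, ∀ y ∈ box n R,
            |boxFn n M L R s x - boxFn n M L R s y| ≤ L * ‖x - y‖) ∧
        -- the oracle and the complexity bounds
        ∃ O : (Fin n → Fin M → Bool) → box n R → ℝ × (Fin n → ℝ),
          IsFirstOrder (box n R) (boxFn n M L R) O ∧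
          IsSingleCoordinate (box n R) (boxFn n M L R) O ∧
          IsLocal (box n R) (boxFn n M L R) O ∧
          ENNReal.ofReal (c * (n * Real.logb 2 (L * R / ε))) ≤
            distComplexity O (fun s => epsMinima n R ε (boxFn n M L R s)) 0 ∧
          ENNReal.ofReal (c * (n * Real.logb 2 (L * R / ε))) ≤
            highProbComplexity O (fun s => epsMinima n R ε (boxFn n M L R s)) 0
              (δ (n * Real.logb 2 (L * R / ε))) ∧
          ∀ Pe : ℝ, 0 ≤ Pe → Pe < 1 →
            (K ≤ (1 - Pe) * (n * Real.logb 2 (L * R / ε)) →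
              ENNReal.ofReal (c * ((1 - Pe) * (n * Real.logb 2 (L * R / ε)))) ≤
                distComplexity O (fun s => epsMinima n R ε (boxFn n M L R s)) Pe) ∧
            ENNReal.ofReal (c * (n * Real.logb 2 (L * R / ε))) ≤
              highProbComplexity O (fun s => epsMinima n R ε (boxFn n M L R s)) Pe
                (δ (n * Real.logb 2 (L * R / ε))) := by
  -- With X = n log(LR/ε) ≤ 6nM, the failure term (9/10)^(nM) is at most (9/10)^(X/6). The factor
  -- 1/240 is 1/6 · 1/4 · 1/10, the last because 1 - (9/10)^(nM) ≥ 1/10; and 108 = 6 · 18.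
  refine ⟨1 / 240, by norm_num, 108, by norm_num, fun X => (9 / 10) ^ (X / 6), ?_, ?_⟩
  · exact (tendsto_rpow_atTop_of_base_lt_one _ (by norm_num) (by norm_num)).comp
      (tendsto_id.atTop_div_const (by norm_num))
  intro n M L R ε hn hL hR hε hεLR hM
  have : NeZero n := ⟨by omega⟩
  have hεM := le_mul_pow_of_eq_stringLength hL hR hε hεLR hM
  have hX := logb_le_of_eq_stringLength hε hεLR hM
  have hX3 := three_le_logb hε hεLR
  set l := Real.logb 2 (L * R / ε)
  have hn1 : (1 : ℝ) ≤ n := by exact_mod_cast hn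
  have hM1 : (1 : ℝ) ≤ M := by
    have : (0 : ℝ) < M := by linarith
    exact_mod_cast this
  have hXm : n * l ≤ 6 * (n * M : ℝ) := by nlinarith
  have hm1 : (1 : ℝ) ≤ n * M := one_le_mul_of_one_le_of_one_le hn1 hM1
  have hm1' : 1 ≤ n * M := by exact_mod_cast hm1
  have hcard : Fintype.card (Fin n × Fin M) = n * M := by simp
  have hI : Fintype.card (Fin n → Fin M → Bool) = 2 ^ Fintype.card (Fin n × Fin M) := by
    rw [hcard, mul_comm, pow_mul]; simp
  have hO := guessChain_steepOracle (n := n) (M := M) (L := L) (R := R)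
  have hG : ∀ (s t : Fin n → Fin M → Bool) (x : box n R),
      x ∈ epsMinima n R ε (boxFn n M L R s) → x ∈ epsMinima n R ε (boxFn n M L R t) → s = t :=
    fun s t x hs ht => eq_of_boxFn_lt hL hR (boxFn_lt_of_mem_epsMinima hL hR hεM hs)
      (boxFn_lt_of_mem_epsMinima hL hR hεM ht)
  have hδ : ((9 : ℝ) / 10) ^ Fintype.card (Fin n × Fin M) ≤ (9 / 10) ^ (n * l / 6) := by
    rw [hcard, ← Real.rpow_natCast]
    refine Real.rpow_le_rpow_of_exponent_ge (by norm_num) (by norm_num) ?_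
    push_cast
    linarith
  have hhigh : ∀ Pe : ℝ, ENNReal.ofReal (1 / 240 * (n * l)) ≤
      highProbComplexity (steepOracle n M L R) (fun s => epsMinima n R ε (boxFn n M L R s)) Pe
        ((9 / 10) ^ (n * l / 6)) := by
    refine fun Pe => (ENNReal.ofReal_le_ofReal ?_).trans (le_highProbComplexity hO hG hI hδ)
    rw [hcard]
    push_cast
    linarith
  have hdist := le_distComplexity hO hG hI
  rw [hcard] at hdist
  push_cast at hdist
  refine ⟨fun s t hst => ?_, fun s => ⟨convexOn_boxFn hL hR s, fun x _ y _ =>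
    abs_boxFn_sub_le hL hR s x y⟩, steepOracle n M L R, isFirstOrder_steepOracle hL hR,
    isSingleCoordinate_steepOracle hL hR, isLocal_steepOracle hL hR, ?_, hhigh 0,
    fun Pe h0 h1 => ⟨fun hK => ?_, hhigh Pe⟩⟩
  · have h : boxFn n M L R s (minPoint R s) < L * R * breakpoint M := by
      rw [boxFn_minPoint hR]
      exact mul_lt_mul_of_pos_left (minValue_lt_breakpoint M) (mul_pos hL hR)
    exact eq_of_boxFn_lt hL hR h (hst (minPoint_mem_box hR s) ▸ h)
  · refine (ENNReal.ofReal_le_ofReal ?_).trans (hdist 0)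
    have h9 : ((9 : ℝ) / 10) ^ (n * M) ≤ 9 / 10 :=
      pow_le_of_le_one (by norm_num) (by norm_num) (by omega)
    nlinarith
  · refine (ENNReal.ofReal_le_ofReal ?_).trans (hdist Pe)
    -- Bernoulli's inequality for (10/9)^(nM) gives decay like 9/(nM), so (1 - Pe)nM ≥ 18 brings the
    -- failure term below (1 - Pe)/2.
    have hpow : ((9 : ℝ) / 10) ^ (n * M) * (1 + n * M / 9) ≤ 1 := by
      have h := one_add_mul_le_pow (a := (1 / 9 : ℝ)) (by norm_num) (n * M)
      calc ((9 : ℝ) / 10) ^ (n * M) * (1 + n * M / 9)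
          ≤ (9 / 10) ^ (n * M) * (1 + 1 / 9) ^ (n * M) := by
            gcongr
            refine le_of_eq_of_le ?_ h
            push_cast; ring
        _ = 1 := by rw [← mul_pow]; norm_num
    have hq : 0 < 1 - Pe := by linarith
    have h18 : 18 ≤ (1 - Pe) * (n * M) := by nlinarith
    have hη : ((9 : ℝ) / 10) ^ (n * M) ≤ (1 - Pe) / 2 := by
      have hpos : (0 : ℝ) < 1 + n * M / 9 := by positivity
      have : 1 ≤ (1 - Pe) / 2 * (1 + n * M / 9) := by nlinarith
      exact le_of_mul_le_mul_right (hpow.trans this) hpos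
    calc 1 / 240 * ((1 - Pe) * (n * l)) ≤ 1 / 240 * ((1 - Pe) * (6 * (n * M))) := by gcongr
      _ ≤ n * M / 4 * ((1 - Pe) / 2) := by nlinarith [mul_nonneg hq.le (zero_le_one.trans hm1)]
      _ ≤ n * M / 4 * (1 - Pe - (9 / 10) ^ (n * M)) := by gcongr; linarith
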